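/- Let $\mathcal V$ be a complete discrete valuation ring of mixed characteristic $(0,p)$ with perfect residue field $\kappa$, uniformizer $\varpi$ and fraction field $K$. Let $\mathfrak X$ be a smooth connected formal curve over $\mathcal V$: a formal $\mathcal V$-scheme with ideal of definition generated by $\varpi$, all of whose reductions modulo $\varpi^{n+1}$ are smooth over $\mathcal V/\varpi^{n+1}$, and whose special fibre is a connected curve over $\kappa$ (smooth of relative dimension $1$). Let $k\ge 0$ be an integer (the congruence level). For an affine open $V=\operatorname{Spf}A$ of $\mathfrak X$, where $A=\mathcal O_{\mathfrak X}(V)$, let $\mathcal D^{(0)}_{\mathfrak X,k}(V)$ be the $\mathcal V$-algebra of differential operators on $A$ generated by $A$ and by the operators $\varpi^k\delta$, where $\delta$ is a $\mathcal V$-derivation of $A$. Put $$\widehat{\mathcal D}^{(0)}_{\mathfrak X,k}(V)=\varprojlim_n \mathcal D^{(0)}_{\mathfrak X,k}(V)/\varpi^{n}\mathcal D^{(0)}_{\mathfrak X,k}(V),\qquad \widehat{\mathcal D}^{(0)}_{\mathfrak X,k,\mathbb Q}(V)=\widehat{\mathcal D}^{(0)}_{\mathfrak X,k}(V)\otimes_{\mathcal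 V}K .$$ (If $V$ carries an étale coordinate with associated derivation $\partial$, the elements of $\widehat{\mathcal D}^{(0)}_{\mathfrak X,k,\mathbb Q}(V)$ are the series $\sum_{n\ge0}a_n(\varpi^k\partial)^n$ with $a_n\in A\otimes_{\mathcal V}K$ and $a_n\to0$.) Then for every nonempty affine open $V$ of $\mathfrak X$, the $K$-algebra $\widehat{\mathcal D}^{(0)}_{\mathfrak X,k,\mathbb Q}(V)$ is simple: it is nonzero and its only two-sided ideals are $0$ and the whole algebra. -/

import Mathlib

open CategoryTheory AlgebraicGeometry TopologicalSpace Opposite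
open scoped TensorProduct

universe u v

section DifferentialOperators

variable {R : Type u} [CommRing R]

/-- For an `R`-algebra `A` (the functions on an affine open) this is the `R`-subalgebra of
`End_R A` generated by the multiplications by elements of `A` and by the operators `ϖ ^ k • δ`,
where `δ` runs through the `R`-derivations of `A`: the differential operators of level `0` and
congruence level `k`. -/
def diffOps (ϖ : R) (k : ℕ) (A : Type v) [CommRing A] [Algebra R A] :
    Subalgebra R (Module.End R A) :=
  Algebra.adjoin R
    (Set.range (fun a : A => LinearMap.mulLeft R a) ∪
      Set.range (fun δ : Derivation R A A => ϖ ^ k • (δ : A →ₗ[R] A)))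

/-- The ideal `ϖ ^ n D` of a (not necessarily commutative) `R`-algebra `D`. -/
def powIdeal (ϖ : R) (D : Type v) [Ring D] [Algebra R D] (n : ℕ) : Ideal D :=
  Ideal.span {algebraMap R D (ϖ ^ n)}

instance powIdeal_isTwoSided (ϖ : R) (D : Type v) [Ring D] [Algebra R D] (n : ℕ) :
    (powIdeal ϖ D n).IsTwoSided where
  mul_mem_of_left {a} b ha := by
    obtain ⟨c, rfl⟩ := Ideal.mem_span_singleton'.1 ha
    refine Ideal.mem_span_singleton'.2 ⟨c * b, ?_⟩
    rw [mul_assoc, mul_assoc, Algebra.commutes]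

lemma powIdeal_succ_le (ϖ : R) (D : Type v) [Ring D] [Algebra R D] (n : ℕ) :
    powIdeal ϖ D (n + 1) ≤ powIdeal ϖ D n := by
  refine (Ideal.span_singleton_le_iff_mem _).2 (Ideal.mem_span_singleton'.2
    ⟨algebraMap R D ϖ, ?_⟩)
  rw [← map_mul, pow_succ']

/-- The `ϖ`-adic completion `lim_n D / ϖ ^ n D` of a (not necessarily commutative)
`R`-algebra `D`, as the algebra of compatible sequences. -/
def adicCompletionAlg (ϖ : R) (D : Type v) [Ring D] [Algebra R D] :
    Subalgebra R (∀ n : ℕ, D ⧸ powIdeal ϖ D n) where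
  carrier := {x | ∀ n, Ideal.Quotient.factorₐ R (powIdeal_succ_le ϖ D n) (x (n + 1)) = x n}
  mul_mem' hx hy n := by simp only [Pi.mul_apply, map_mul, hx n, hy n]
  add_mem' hx hy n := by simp only [Pi.add_apply, map_add, hx n, hy n]
  algebraMap_mem' r n := by simp only [Pi.algebraMap_apply, AlgHom.commutes]

/-- The completed operators of congruence level `k`, `lim_n D / ϖ ^ n D` for
`D = diffOps ϖ k A`. -/
abbrev completedDiffOps (ϖ : R) (k : ℕ) (A : Type v) [CommRing A] [Algebra R A] :=
  adicCompletionAlg ϖ (diffOps ϖ k A)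

end DifferentialOperators

/-- A locally ringed space over `R`: a locally ringed space together with a morphism to `Spec R`,
that is, with a ring homomorphism from `R` to its ring of global functions. -/
structure LRSOver (R : Type u) [CommRing R] where
  toLRS : LocallyRingedSpace.{u}
  str : R →+* toLRS.presheaf.obj (op ⊤)

namespace LRSOver

variable {R : Type u} [CommRing R] (X : LRSOver R)

/-- The ring of functions on an open subset. -/
def functions (V : Opens X.toLRS) : Type u := X.toLRS.presheaf.obj (op V)

noncomputable instance (V : Opens X.toLRS) : CommRing (X.functions V) :=
  inferInstanceAs (CommRing (X.toLRS.presheaf.obj (op V)))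

/-- Restriction of functions. -/
noncomputable def res {V W : Opens X.toLRS} (h : W ≤ V) : X.functions V →+* X.functions W :=
  (X.toLRS.presheaf.map (homOfLE h).op).hom

noncomputable instance (V : Opens X.toLRS) : Algebra R (X.functions V) :=
  ((X.res (le_top : V ≤ ⊤)).comp X.str).toAlgebra

/-- The open subset `V_f` of the points of `V` at which `f` is invertible. -/
def basicOpen {V : Opens X.toLRS} (f : X.functions V) : Opens X.toLRS :=
  X.toLRS.toRingedSpace.basicOpen (U := V) f

lemma basicOpen_le {V : Opens X.toLRS} (f : X.functions V) : X.basicOpen f ≤ V :=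
  X.toLRS.toRingedSpace.basicOpen_le (U := V) f

/-- The canonical map from `V` to the spectrum of the ring of functions on `V`: a point goes to
the prime ideal of the functions that are not invertible at it. -/
noncomputable def toSpec (V : Opens X.toLRS) (x : V) : PrimeSpectrum (X.functions V) :=
  PrimeSpectrum.comap (X.toLRS.presheaf.germ V x.1 x.2).hom
    (IsLocalRing.closedPoint (X.toLRS.presheaf.stalk x.1))

/-- `V` is an affine formal open: it is the formal spectrum of its ring of functions `A`, for the
`ϖ`-adic topology. That is, `A` is `ϖ`-adically complete, `V` is identified
with the closed subset `V(ϖ)` of `Spec A`, and for every `f ∈ A` the ring of functions on `V_f`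
is the `ϖ`-adic completion of the localisation `A_f`. -/
structure IsFormalAffine (ϖ : R) (V : Opens X.toLRS) : Prop where
  complete : IsAdicComplete (Ideal.span {ϖ}) (X.functions V)
  isEmbedding : Topology.IsEmbedding (X.toSpec V)
  range_eq : Set.range (X.toSpec V) =
    PrimeSpectrum.zeroLocus {algebraMap R (X.functions V) ϖ}
  /-- The functions on `V_f` are `ϖ`-adically complete ... -/
  complete_basicOpen : ∀ f : X.functions V,
    IsAdicComplete (Ideal.span {ϖ}) (X.functions (X.basicOpen f))
  /-- ... and `A_f / ϖ ^ n → Γ(V_f) / ϖ ^ n` is injective ... -/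
  injective_basicOpen : ∀ (f a : X.functions V) (n : ℕ),
    (∃ c, X.res (X.basicOpen_le f) a = ϖ ^ n • c) → ∃ (m : ℕ) (b : X.functions V),
      f ^ m * a = ϖ ^ n • b
  /-- ... and surjective. -/
  surjective_basicOpen : ∀ (f : X.functions V) (g : X.functions (X.basicOpen f)) (n : ℕ),
    ∃ (m : ℕ) (a : X.functions V) (c : X.functions (X.basicOpen f)),
      X.res (X.basicOpen_le f) (f ^ m) * g = X.res (X.basicOpen_le f) a + ϖ ^ n • c

/-- `X` is a smooth connected formal curve over the discrete valuation ring `R` with ideal of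
definition generated by the uniformizer `ϖ`: it is covered by affine formal opens; for every
affine formal open `Spf A` and every `n`, the algebra `A / ϖ ^ (n + 1)` is smooth over
`R / ϖ ^ (n + 1)`, and the special fibre `A / ϖ` has relative dimension `1` over `R / ϖ`
(its module of differentials has rank one everywhere); and the underlying space, which is
the one of the special fibre, is connected. -/
structure IsSmoothFormalCurve (ϖ : R) : Prop where
  locally_affine : ∀ x : X.toLRS, ∃ V : Opens X.toLRS, x ∈ V ∧ X.IsFormalAffine ϖ V
  smooth : ∀ V : Opens X.toLRS, X.IsFormalAffine ϖ V → ∀ n : ℕ,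
    Algebra.Smooth (R ⧸ Ideal.span {ϖ ^ (n + 1)})
      ((R ⧸ Ideal.span {ϖ ^ (n + 1)}) ⊗[R] X.functions V)
  relDim : ∀ V : Opens X.toLRS, X.IsFormalAffine ϖ V →
    ∀ p : PrimeSpectrum ((R ⧸ Ideal.span {ϖ}) ⊗[R] X.functions V),
      Module.rankAtStalk
        (Ω[((R ⧸ Ideal.span {ϖ}) ⊗[R] X.functions V)⁄(R ⧸ Ideal.span {ϖ})]) p = 1
  connected : ConnectedSpace X.toLRS

end LRSOver

-- A nonzero ideal of the rational algebra contracts to a nonzero `ϖ`-saturated two-sided ideal `T`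
-- of the completion. An element of `T` that is `1` modulo `ϖ` has a right inverse by a geometric
-- series, so it is enough to find `1` in the image of `T` modulo `ϖ` (`isSimpleRing_tensorProduct`,
-- `isSimpleRing_adicCompletionAlg`). No series expansions are needed: `T` is replaced by the
-- preimages `I s` in the uncompleted algebra of its images modulo `ϖ ^ s`, where every operator has
-- finite order.
--
-- The `m`-fold commutator of an operator of order `m` with a function `f` isolates its symbol,
-- multiplied by `m! ϖ ^ (k m)`. This factor is nonzero in characteristic zero, and saturation
-- removes it at the cost of passing to a deeper level of the tower
-- (`IsIdealTower.mem_of_adOp_pow_eq`). Taking an operator of least order not divisible by `ϖ`, and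
-- then lifting functions level by level, gives a function `a` not divisible by `ϖ` that lies in
-- every `I s` (`IsIdealTower.exists_function_forall`).
--
-- Let `J` be the ideal of functions lying in every `I s`. It is saturated, closed and stable under
-- derivations. Since `a` cuts out a finite subscheme of the special fibre, `B = A / J` is finite
-- and free over the base. Multiplication by `δ f` on `B` is the commutator of the induced
-- derivation with multiplication by `f`, so it has trace zero. The values `δ f` generate the unit
-- ideal, so the trace of `1`, which is the rank of `B`, vanishes; in characteristic zero this gives
-- `B = 0` and `1 ∈ J` (`subsingleton_of_derivations`).
--
-- The geometric input is that a connected smooth curve is irreducible with integral affine opens,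
-- that its proper closed subschemes are finite, and that its derivations are proportional with
-- values generating the unit ideal. Lifting derivations by formal smoothness carries the last two
-- facts from the special fibre to `A` (`span_coordinateJacobians_eq_top`).

universe w

/-! ### Order filtration, commutators with functions, and symbols. -/

section OrderFiltration

variable {R : Type u} [CommRing R] {A : Type v} [CommRing A] [Algebra R A]

/-- Multiplication by `a`, as an operator on `A`. -/
def mulOp (R : Type u) [CommRing R] {A : Type v} [CommRing A] [Algebra R A] (a : A) :
    Module.End R A := LinearMap.mulLeft R a

@[simp]
lemma mulOp_apply (a b : A) : mulOp R a b = a * b := rfl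

/-- The operator `ϖ ^ k • δ`. -/
def derOp (ϖ : R) (k : ℕ) (δ : Derivation R A A) : Module.End R A :=
  ϖ ^ k • (δ : A →ₗ[R] A)

variable (R A) in
/-- The operators of order zero. -/
def mulOps : Submodule R (Module.End R A) :=
  Submodule.span R (Set.range (mulOp R : A → Module.End R A))

variable (A) in
/-- The operators `ϖ ^ k • δ` for `δ` a derivation. -/
def derOps (ϖ : R) (k : ℕ) : Submodule R (Module.End R A) :=
  Submodule.span R (Set.range (derOp ϖ k : Derivation R A A → Module.End R A))

variable (A) in
/-- The filtration by the order, shifted by one: `orderFiltration ϖ k A (n + 1)` consists of the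
operators of order at most `n`. -/
def orderFiltration (ϖ : R) (k : ℕ) : ℕ → Submodule R (Module.End R A)
  | 0 => ⊥
  | n + 1 => mulOps R A ⊔ orderFiltration ϖ k n * derOps A ϖ k

lemma mulOp_mul (a b : A) : mulOp R (a * b) = mulOp R a * mulOp R b := by
  ext x; simp [mul_assoc]

lemma mulOp_add (a b : A) : mulOp R (a + b) = mulOp R a + mulOp R b := by
  ext x; simp [add_mul]

lemma mulOp_smul (r : R) (a : A) : mulOp R (r • a) = r • mulOp R a := by
  ext x; simp

lemma mulOp_one : mulOp R (1 : A) = 1 := by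
  ext x; simp

lemma mulOp_zero : mulOp R (0 : A) = 0 := by
  ext x; simp

lemma mulOp_comm (a b : A) : mulOp R a * mulOp R b = mulOp R b * mulOp R a := by
  rw [← mulOp_mul, ← mulOp_mul, mul_comm]

lemma mem_mulOps {P : Module.End R A} : P ∈ mulOps R A ↔ ∃ a, P = mulOp R a := by
  refine ⟨fun h => ?_, ?_⟩
  · induction h using Submodule.span_induction with
    | mem x h => obtain ⟨a, rfl⟩ := h; exact ⟨a, rfl⟩
    | zero => exact ⟨0, mulOp_zero.symm⟩
    | add x y _ _ hx hy =>
      obtain ⟨a, rfl⟩ := hx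
      obtain ⟨b, rfl⟩ := hy
      exact ⟨a + b, (mulOp_add a b).symm⟩
    | smul r x _ hx =>
      obtain ⟨a, rfl⟩ := hx
      exact ⟨r • a, (mulOp_smul r a).symm⟩
  · rintro ⟨a, rfl⟩
    exact Submodule.subset_span ⟨a, rfl⟩

lemma mulOp_mem_mulOps (a : A) : mulOp R a ∈ mulOps R A := mem_mulOps.2 ⟨a, rfl⟩

variable (ϖ : R) (k : ℕ)

lemma derOp_mul_mulOp (δ : Derivation R A A) (a : A) :
    derOp ϖ k δ * mulOp R a = mulOp R a * derOp ϖ k δ + ϖ ^ k • mulOp R (δ a) := by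
  ext x
  simp [derOp, mul_comm]

lemma mem_derOps {P : Module.End R A} : P ∈ derOps A ϖ k ↔ ∃ δ, P = derOp ϖ k δ := by
  refine ⟨fun h => ?_, ?_⟩
  · induction h using Submodule.span_induction with
    | mem x h => obtain ⟨a, rfl⟩ := h; exact ⟨a, rfl⟩
    | zero => exact ⟨0, by ext; simp [derOp]⟩
    | add x y _ _ hx hy =>
      obtain ⟨a, rfl⟩ := hx
      obtain ⟨b, rfl⟩ := hy
      exact ⟨a + b, by ext; simp [derOp]⟩
    | smul r x _ hx =>
      obtain ⟨a, rfl⟩ := hx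
      exact ⟨r • a, by ext; simp [derOp, smul_comm r]⟩
  · rintro ⟨a, rfl⟩
    exact Submodule.subset_span ⟨a, rfl⟩

lemma derOp_mem_derOps (δ : Derivation R A A) : derOp ϖ k δ ∈ derOps A ϖ k :=
  (mem_derOps ϖ k).2 ⟨δ, rfl⟩

lemma orderFiltration_succ (n : ℕ) : orderFiltration A ϖ k (n + 1) =
    mulOps R A ⊔ orderFiltration A ϖ k n * derOps A ϖ k := rfl

/-- Induction on the operators of order at most `n`. -/
lemma orderFiltration_succ_induction {n : ℕ} {p : Module.End R A → Prop}
    (hmul : ∀ a, p (mulOp R a))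
    (hder : ∀ P ∈ orderFiltration A ϖ k n, ∀ δ, p (P * derOp ϖ k δ))
    (hadd : ∀ P Q, p P → p Q → p (P + Q)) :
    ∀ P ∈ orderFiltration A ϖ k (n + 1), p P := by
  intro P hP
  rw [orderFiltration_succ] at hP
  obtain ⟨P₁, h₁, P₂, h₂, rfl⟩ := Submodule.mem_sup.1 hP
  have h₃ : p P₂ := by
    clear h₁ hP
    induction h₂ using Submodule.mul_induction_on' with
    | mem_mul_mem m hm w hw =>
      obtain ⟨δ, rfl⟩ := (mem_derOps ϖ k).1 hw
      exact hder m hm δ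
    | add x hx y hy ihx ihy => exact hadd _ _ ihx ihy
  obtain ⟨a, rfl⟩ := mem_mulOps.1 h₁
  exact hadd _ _ (hmul a) h₃

lemma mulOp_mem_orderFiltration (n : ℕ) (a : A) :
    mulOp R a ∈ orderFiltration A ϖ k (n + 1) :=
  Submodule.mem_sup_left (mulOp_mem_mulOps a)

lemma mul_derOp_mem_orderFiltration {n : ℕ} {P : Module.End R A}
    (hP : P ∈ orderFiltration A ϖ k n) (δ : Derivation R A A) :
    P * derOp ϖ k δ ∈ orderFiltration A ϖ k (n + 1) :=
  Submodule.mem_sup_right (Submodule.mul_mem_mul hP (derOp_mem_derOps ϖ k δ))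

lemma orderFiltration_le_succ (n : ℕ) :
    orderFiltration A ϖ k n ≤ orderFiltration A ϖ k (n + 1) := by
  induction n with
  | zero => exact bot_le
  | succ n ih => exact sup_le_sup_left (mul_le_mul' ih le_rfl) _

lemma orderFiltration_mono : Monotone (orderFiltration A ϖ k) :=
  monotone_nat_of_le_succ (orderFiltration_le_succ ϖ k)

lemma mulOp_mul_mem_orderFiltration {n : ℕ} (a : A) :
    ∀ P ∈ orderFiltration A ϖ k n, mulOp R a * P ∈ orderFiltration A ϖ k n := by
  induction n with
  | zero =>
    intro P hP
    rw [show P = 0 from hP, mul_zero]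
    exact Submodule.zero_mem _
  | succ n ih =>
    refine orderFiltration_succ_induction ϖ k (fun b => ?_) (fun P hP δ => ?_) fun P Q hP hQ => ?_
    · rw [← mulOp_mul]
      exact mulOp_mem_orderFiltration ϖ k n _
    · rw [← mul_assoc]
      exact mul_derOp_mem_orderFiltration ϖ k (ih P hP) δ
    · rw [mul_add]
      exact Submodule.add_mem _ hP hQ

lemma mul_mulOp_mem_orderFiltration {n : ℕ} (a : A) :
    ∀ P ∈ orderFiltration A ϖ k n, P * mulOp R a ∈ orderFiltration A ϖ k n := by
  induction n generalizing a with
  | zero =>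
    intro P hP
    rw [show P = 0 from hP, zero_mul]
    exact Submodule.zero_mem _
  | succ n ih =>
    refine orderFiltration_succ_induction ϖ k (fun b => ?_) (fun P hP δ => ?_) fun P Q hP hQ => ?_
    · rw [← mulOp_mul]
      exact mulOp_mem_orderFiltration ϖ k n _
    · rw [mul_assoc, derOp_mul_mulOp, mul_add, ← mul_assoc, mul_smul_comm]
      exact Submodule.add_mem _ (mul_derOp_mem_orderFiltration ϖ k (ih a P hP) δ)
        (Submodule.smul_mem _ _ (orderFiltration_le_succ ϖ k n (ih _ P hP)))
    · rw [add_mul]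
      exact Submodule.add_mem _ hP hQ

/-- By the Leibniz rule, moving a function past one `ϖ ^ k • δ` leaves a function in its place, so
the order drops by one. -/
lemma commutator_mem_orderFiltration {n : ℕ} (a : A) :
    ∀ P ∈ orderFiltration A ϖ k (n + 1),
      mulOp R a * P - P * mulOp R a ∈ orderFiltration A ϖ k n := by
  induction n with
  | zero =>
    refine orderFiltration_succ_induction ϖ k (fun b => ?_) (fun P hP δ => ?_) fun P Q hP hQ => ?_
    · rw [mulOp_comm, sub_self]
      exact Submodule.zero_mem _
    · rw [show P = 0 from hP]
      simp
    · rw [mul_add, add_mul, add_sub_add_comm]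
      exact Submodule.add_mem _ hP hQ
  | succ n ih =>
    refine orderFiltration_succ_induction ϖ k (fun b => ?_) (fun P hP δ => ?_) fun P Q hP hQ => ?_
    · rw [mulOp_comm, sub_self]
      exact Submodule.zero_mem _
    · have : mulOp R a * (P * derOp ϖ k δ) - P * derOp ϖ k δ * mulOp R a =
          (mulOp R a * P - P * mulOp R a) * derOp ϖ k δ - ϖ ^ k • (P * mulOp R (δ a)) := by
        rw [mul_assoc P, derOp_mul_mulOp, mul_add, mul_smul_comm]
        simp only [sub_mul, mul_assoc]
        abel
      rw [this]
      exact Submodule.sub_mem _ (mul_derOp_mem_orderFiltration ϖ k (ih P hP) δ)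
        (Submodule.smul_mem _ _ (mul_mulOp_mem_orderFiltration ϖ k _ P hP))
    · rw [mul_add, add_mul, add_sub_add_comm]
      exact Submodule.add_mem _ hP hQ

lemma derOp_pow_mem_orderFiltration (δ : Derivation R A A) (n : ℕ) :
    derOp ϖ k δ ^ n ∈ orderFiltration A ϖ k (n + 1) := by
  induction n with
  | zero =>
    rw [pow_zero, ← mulOp_one]
    exact mulOp_mem_orderFiltration ϖ k 0 1
  | succ n ih =>
    rw [pow_succ]
    exact mul_derOp_mem_orderFiltration ϖ k ih δ

lemma mulOp_mem_diffOps (a : A) : mulOp R a ∈ diffOps ϖ k A :=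
  Algebra.subset_adjoin (Or.inl ⟨a, rfl⟩)

lemma derOp_mem_diffOps (δ : Derivation R A A) : derOp ϖ k δ ∈ diffOps ϖ k A :=
  Algebra.subset_adjoin (Or.inr ⟨δ, rfl⟩)

lemma orderFiltration_le_diffOps (n : ℕ) :
    orderFiltration A ϖ k n ≤ Subalgebra.toSubmodule (diffOps ϖ k A) := by
  induction n with
  | zero => exact bot_le
  | succ n ih =>
    exact orderFiltration_succ_induction ϖ k (mulOp_mem_diffOps ϖ k)
      (fun P hP δ => Subalgebra.mul_mem _ (ih hP) (derOp_mem_diffOps ϖ k δ))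
      fun P Q hP hQ => Subalgebra.add_mem _ hP hQ

lemma exists_mem_orderFiltration {P : Module.End R A} (hP : P ∈ diffOps ϖ k A) :
    ∃ n, P ∈ orderFiltration A ϖ k n := by
  rw [diffOps, ← Subalgebra.mem_toSubmodule, Algebra.adjoin_eq_span] at hP
  induction hP using Submodule.span_induction with
  | mem x h =>
    induction h using Submonoid.closure_induction_right with
    | one => exact ⟨1, by rw [← mulOp_one]; exact mulOp_mem_orderFiltration ϖ k 0 1⟩
    | mul_right x _ y hy ih =>
      obtain ⟨n, hn⟩ := ih
      obtain ⟨a, rfl⟩ | ⟨δ, rfl⟩ := hy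
      · exact ⟨n, mul_mulOp_mem_orderFiltration ϖ k a x hn⟩
      · exact ⟨n + 1, mul_derOp_mem_orderFiltration ϖ k hn δ⟩
  | zero => exact ⟨0, Submodule.zero_mem _⟩
  | add x y _ _ hx hy =>
    obtain ⟨n, hn⟩ := hx
    obtain ⟨m, hm⟩ := hy
    exact ⟨max n m, Submodule.add_mem _ (orderFiltration_mono ϖ k (le_max_left n m) hn)
      (orderFiltration_mono ϖ k (le_max_right n m) hm)⟩
  | smul r x _ hx =>
    obtain ⟨n, hn⟩ := hx
    exact ⟨n, Submodule.smul_mem _ _ hn⟩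

/-- The commutator `P ↦ P f - f P`. -/
def adOp (R : Type u) [CommRing R] {A : Type v} [CommRing A] [Algebra R A] (f : A) :
    Module.End R A →ₗ[R] Module.End R A :=
  LinearMap.mulRight R (mulOp R f) - LinearMap.mulLeft R (mulOp R f)

lemma adOp_apply (f : A) (P : Module.End R A) :
    adOp R f P = P * mulOp R f - mulOp R f * P := rfl

lemma adOp_mulOp (f a : A) : adOp R f (mulOp R a) = 0 := by
  rw [adOp_apply, mulOp_comm, sub_self]

lemma adOp_mul_mulOp (f a : A) (P : Module.End R A) :
    adOp R f (P * mulOp R a) = adOp R f P * mulOp R a := by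
  rw [adOp_apply, adOp_apply, mul_assoc, mulOp_comm]
  simp only [sub_mul, mul_assoc]

lemma adOp_mul_derOp (f : A) (P : Module.End R A) (δ : Derivation R A A) :
    adOp R f (P * derOp ϖ k δ) = adOp R f P * derOp ϖ k δ + ϖ ^ k • (P * mulOp R (δ f)) := by
  rw [adOp_apply, adOp_apply, mul_assoc, derOp_mul_mulOp, mul_add, mul_smul_comm]
  simp only [sub_mul, mul_assoc]
  abel

lemma adOp_pow_succ_mulOp (f a : A) (m : ℕ) : (adOp R f ^ (m + 1)) (mulOp R a) = 0 := by
  rw [pow_succ, Module.End.mul_apply, adOp_mulOp, map_zero]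

/-- The Leibniz formula for an iterated commutator stops after two terms: the commutator of `ϖ ^ k •
δ` with `f` is a function, which commutes with `f`. The factor `m + 1` counts which of the
commutators hits the derivation. -/
lemma adOp_pow_mul_derOp (f : A) (P : Module.End R A) (δ : Derivation R A A) (m : ℕ) :
    (adOp R f ^ (m + 1)) (P * derOp ϖ k δ) = (adOp R f ^ (m + 1)) P * derOp ϖ k δ +
      ((m + 1 : ℕ) * ϖ ^ k : R) • ((adOp R f ^ m) P * mulOp R (δ f)) := by
  induction m with
  | zero => simp [adOp_mul_derOp]
  | succ m ih =>
    have h (n : ℕ) (Q : Module.End R A) : adOp R f ((adOp R f ^ n) Q) = (adOp R f ^ (n + 1)) Q := by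
      rw [pow_succ', Module.End.mul_apply]
    rw [← h (m + 1), ih, map_add, map_smul, adOp_mul_derOp, adOp_mul_mulOp, h, h,
      add_assoc, ← add_smul]
    congr 2
    push_cast
    ring

lemma adOp_pow_eq_zero (f : A) {n : ℕ} :
    ∀ P ∈ orderFiltration A ϖ k n, (adOp R f ^ n) P = 0 := by
  induction n with
  | zero =>
    intro P hP
    rw [show P = 0 from hP, map_zero]
  | succ n ih =>
    refine orderFiltration_succ_induction ϖ k (fun b => adOp_pow_succ_mulOp f b n)
      (fun P hP δ => ?_) fun P Q hP hQ => ?_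
    · rw [adOp_pow_mul_derOp, ih P hP, pow_succ', Module.End.mul_apply, ih P hP]
      simp
    · rw [map_add, hP, hQ, add_zero]

/-- The `m`-fold commutator with a function is divisible by `m! ϖ ^ (k m)`. -/
lemma exists_adOp_pow_eq (f : A) {P : Module.End R A} (hP : P ∈ diffOps ϖ k A) (m : ℕ) :
    ∃ Q ∈ diffOps ϖ k A, (adOp R f ^ m) P = ((m.factorial : R) * ϖ ^ (k * m)) • Q := by
  obtain ⟨n, hn⟩ := exists_mem_orderFiltration ϖ k hP
  clear hP
  induction n generalizing P m with
  | zero =>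
    rw [show P = 0 from hn]
    exact ⟨0, Subalgebra.zero_mem _, by simp⟩
  | succ n ih =>
    revert P
    refine fun {P} hP => orderFiltration_succ_induction ϖ k (p := fun P => ∃ Q ∈ diffOps ϖ k A,
      (adOp R f ^ m) P = ((m.factorial : R) * ϖ ^ (k * m)) • Q)
      (fun a => ?_) (fun P hP δ => ?_) (fun P Q hP hQ => ?_) P hP
    · cases m with
      | zero => exact ⟨mulOp R a, mulOp_mem_diffOps ϖ k a, by simp⟩
      | succ m => exact ⟨0, Subalgebra.zero_mem _, by rw [adOp_pow_succ_mulOp, smul_zero]⟩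
    · cases m with
      | zero =>
        exact ⟨P * derOp ϖ k δ, Subalgebra.mul_mem _ (orderFiltration_le_diffOps ϖ k n hP)
          (derOp_mem_diffOps ϖ k δ), by simp⟩
      | succ m =>
        obtain ⟨Q, hQ, h⟩ := ih m hP
        obtain ⟨Q', hQ', h'⟩ := ih (m + 1) hP
        refine ⟨Q' * derOp ϖ k δ + Q * mulOp R (δ f), Subalgebra.add_mem _
          (Subalgebra.mul_mem _ hQ' (derOp_mem_diffOps ϖ k δ))
          (Subalgebra.mul_mem _ hQ (mulOp_mem_diffOps ϖ k _)), ?_⟩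
        rw [adOp_pow_mul_derOp, h, h', smul_add, smul_mul_assoc, smul_mul_assoc, smul_smul]
        congr 2
        rw [Nat.factorial_succ]
        push_cast
        ring
    · obtain ⟨P', hP', h⟩ := hP
      obtain ⟨Q', hQ', h'⟩ := hQ
      exact ⟨P' + Q', Subalgebra.add_mem _ hP' hQ', by rw [map_add, h, h', smul_add]⟩

variable (R) in
/-- The functions of the form `δ f` such that `δ f • τ = τ f • δ` for all derivations `τ`. -/
def coordinateJacobians (A : Type v) [CommRing A] [Algebra R A] : Set A :=
  {g | ∃ (δ : Derivation R A A) (f : A), g = δ f ∧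
    ∀ (τ : Derivation R A A) (h : A), g * τ h = τ f * δ h}

/-- The symbol of an operator of order at most `N` is computed by `N`-fold commutators. -/
lemma exists_symbol {δ : Derivation R A A} {f : A}
    (hδ : ∀ (τ : Derivation R A A) (h : A), δ f * τ h = τ f * δ h) {N : ℕ} :
    ∀ P ∈ orderFiltration A ϖ k (N + 1), ∃ q : A,
      (adOp R f ^ N) P = ((N.factorial : R) * ϖ ^ (k * N)) • mulOp R q ∧
      mulOp R (δ f ^ N) * P - mulOp R q * derOp ϖ k δ ^ N ∈ orderFiltration A ϖ k N := by
  have hadd : ∀ (N : ℕ) (P Q : Module.End R A), (∃ q : A,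
      (adOp R f ^ N) P = ((N.factorial : R) * ϖ ^ (k * N)) • mulOp R q ∧
      mulOp R (δ f ^ N) * P - mulOp R q * derOp ϖ k δ ^ N ∈ orderFiltration A ϖ k N) → (∃ q : A,
      (adOp R f ^ N) Q = ((N.factorial : R) * ϖ ^ (k * N)) • mulOp R q ∧
      mulOp R (δ f ^ N) * Q - mulOp R q * derOp ϖ k δ ^ N ∈ orderFiltration A ϖ k N) → (∃ q : A,
      (adOp R f ^ N) (P + Q) = ((N.factorial : R) * ϖ ^ (k * N)) • mulOp R q ∧
      mulOp R (δ f ^ N) * (P + Q) - mulOp R q * derOp ϖ k δ ^ N ∈ orderFiltration A ϖ k N) := by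
    rintro N P Q ⟨q, h₁, h₂⟩ ⟨q', h₁', h₂'⟩
    refine ⟨q + q', by rw [map_add, h₁, h₁', mulOp_add, smul_add], ?_⟩
    rw [mulOp_add, mul_add, add_mul, add_sub_add_comm]
    exact Submodule.add_mem _ h₂ h₂'
  induction N with
  | zero =>
    refine orderFiltration_succ_induction ϖ k (fun a => ⟨a, by simp, ?_⟩) (fun P hP τ => ?_)
      (hadd 0)
    · simp [mulOp_one]
    · rw [show P = 0 from hP, zero_mul]
      exact ⟨0, by simp [mulOp_zero], by simp [mulOp_zero]⟩
  | succ N ih =>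
    refine orderFiltration_succ_induction ϖ k (fun a => ⟨0, ?_, ?_⟩) (fun P hP τ => ?_)
      (hadd (N + 1))
    · rw [adOp_pow_succ_mulOp, mulOp_zero, smul_zero]
    · rw [mulOp_zero, zero_mul, sub_zero, ← mulOp_mul]
      exact mulOp_mem_orderFiltration ϖ k N _
    · obtain ⟨q, h₁, h₂⟩ := ih P hP
      refine ⟨q * τ f, ?_, ?_⟩
      · rw [adOp_pow_mul_derOp, adOp_pow_eq_zero ϖ k f P hP, h₁, zero_mul, zero_add,
          smul_mul_assoc, smul_smul, mulOp_mul, Nat.factorial_succ]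
        congr 1
        push_cast
        ring
      -- The Jacobian condition turns an arbitrary `τ` into a multiple of `δ` after multiplication
      -- by `δ f`.
      · have key : mulOp R (δ f) * derOp ϖ k τ = mulOp R (τ f) * derOp ϖ k δ := by
          ext x
          simp [derOp, hδ τ x]
        set g := mulOp R (δ f) with hg
        set c := mulOp R (τ f) with hc
        set d := derOp ϖ k δ with hd
        set w := derOp ϖ k τ with hw
        set q' := mulOp R q with hq'
        have hgq : g * q' = q' * g := mulOp_comm _ _
        -- The difference is the inductive error times `w`, plus terms containing commutators of
        -- functions with `d ^ N`; each has order one less than the two operators compared.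
        have e : mulOp R (δ f ^ (N + 1)) * (P * w) - mulOp R (q * τ f) * d ^ (N + 1) =
            g * (mulOp R (δ f ^ N) * P - q' * d ^ N) * w + q' * (g * d ^ N - d ^ N * g) * w -
              q' * (c * d ^ N - d ^ N * c) * d := by
          have e₁ : q' * d ^ N * (g * w) = q' * d ^ N * (c * d) := by rw [key]
          have e₂ : g * q' * d ^ N * w = q' * g * d ^ N * w := by rw [hgq]
          rw [mulOp_mul, pow_succ' (δ f), mulOp_mul, pow_succ d]
          simp only [mul_sub, sub_mul, ← mul_assoc] at e₁ e₂ ⊢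
          rw [e₁, e₂]
          abel
        rw [e]
        have hdN := derOp_pow_mem_orderFiltration ϖ k δ N
        refine Submodule.sub_mem _ (Submodule.add_mem _ ?_ ?_) ?_
        · exact mul_derOp_mem_orderFiltration ϖ k (mulOp_mul_mem_orderFiltration ϖ k _ _ h₂) τ
        · exact mul_derOp_mem_orderFiltration ϖ k (mulOp_mul_mem_orderFiltration ϖ k _ _
            (commutator_mem_orderFiltration ϖ k _ _ hdN)) τ
        · exact mul_derOp_mem_orderFiltration ϖ k (mulOp_mul_mem_orderFiltration ϖ k _ _
            (commutator_mem_orderFiltration ϖ k _ _ hdN)) δ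

end OrderFiltration

/-! ### Ideal towers and the functions they contain. -/

section Tower

variable {R : Type u} [CommRing R] {A : Type v} [CommRing A] [Algebra R A]

/-- A compatible system of two-sided ideals `I s` of `diffOps ϖ k A`, to be thought of as the
images modulo `ϖ ^ s` of a `ϖ`-saturated two-sided ideal of the completion. -/
structure IsIdealTower (ϖ : R) (k : ℕ) (I : ℕ → Submodule R (Module.End R A)) : Prop where
  mul_left : ∀ s, ∀ P ∈ diffOps ϖ k A, ∀ Q ∈ I s, P * Q ∈ I s
  mul_right : ∀ s, ∀ P ∈ diffOps ϖ k A, ∀ Q ∈ I s, Q * P ∈ I s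
  mem_diffOps : ∀ s, ∀ P ∈ I s, P ∈ diffOps ϖ k A
  pow_smul_mem : ∀ s, ∀ P ∈ diffOps ϖ k A, ϖ ^ s • P ∈ I s
  lift : ∀ s, ∀ P ∈ I s, ∃ P' ∈ I (s + 1), ∃ Q ∈ diffOps ϖ k A, P = P' + ϖ ^ s • Q
  saturated : ∀ s, ∀ P ∈ diffOps ϖ k A, ϖ • P ∈ I (s + 1) → P ∈ I s

lemma Module.End.smul_eq_zero_of_torsionFree {r : R} (hr : ∀ a : A, r • a = 0 → a = 0)
    {P : Module.End R A} (h : r • P = 0) : P = 0 := by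
  ext a
  exact hr _ (by simpa using LinearMap.congr_fun h a)

variable {ϖ : R} {k : ℕ}

lemma IsDiscreteValuationRing.smul_eq_zero_of_irreducible [IsDomain R] [IsDiscreteValuationRing R]
    {M : Type*} [AddCommGroup M] [Module R M] (hϖ : Irreducible ϖ)
    (htf : ∀ a : M, ϖ • a = 0 → a = 0) {r : R} (hr : r ≠ 0) {a : M} (h : r • a = 0) : a = 0 := by
  obtain ⟨n, u, rfl⟩ := IsDiscreteValuationRing.eq_unit_mul_pow_irreducible hr hϖ
  have h' : ϖ ^ n • a = 0 := by
    have := congrArg (fun x => (↑u⁻¹ : R) • x) h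
    simpa [smul_smul] using this
  clear h hr
  induction n with
  | zero => simpa using h'
  | succ n ih => exact ih (htf _ (by rwa [smul_smul, ← pow_succ']))

namespace IsIdealTower

variable {I : ℕ → Submodule R (Module.End R A)} (hI : IsIdealTower ϖ k I)
include hI

lemma exists_lift (s v : ℕ) {P : Module.End R A} (hP : P ∈ I s) :
    ∃ P' ∈ I (s + v), ∃ Q ∈ diffOps ϖ k A, P = P' + ϖ ^ s • Q := by
  induction v with
  | zero => exact ⟨P, hP, 0, Subalgebra.zero_mem _, by simp⟩
  | succ v ih =>
    obtain ⟨P', hP', Q, hQ, rfl⟩ := ih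
    obtain ⟨P'', hP'', Q', hQ', rfl⟩ := hI.lift _ P' hP'
    refine ⟨P'', hP'', Q + ϖ ^ v • Q', Subalgebra.add_mem _ hQ (Subalgebra.smul_mem _ hQ' _), ?_⟩
    rw [pow_add, mul_smul, smul_add]
    abel

lemma le_of_succ (s : ℕ) {P : Module.End R A} (hP : P ∈ I (s + 1)) : P ∈ I s :=
  hI.saturated s P (hI.mem_diffOps _ P hP) (Submodule.smul_mem _ _ hP)

lemma saturated_pow (s v : ℕ) {P : Module.End R A} (hP : P ∈ diffOps ϖ k A)
    (h : ϖ ^ v • P ∈ I (s + v)) : P ∈ I s := by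
  induction v with
  | zero => simpa using h
  | succ v ih =>
    refine ih (hI.saturated _ _ (Subalgebra.smul_mem _ hP _) ?_)
    rwa [smul_smul, ← pow_succ']

lemma adOp_mem (s : ℕ) (f : A) {P : Module.End R A} (hP : P ∈ I s) (m : ℕ) :
    (adOp R f ^ m) P ∈ I s := by
  induction m with
  | zero => simpa using hP
  | succ m ih =>
    rw [pow_succ', Module.End.mul_apply, adOp_apply]
    exact Submodule.sub_mem _ (hI.mul_right _ _ (mulOp_mem_diffOps ϖ k f) _ ih)
      (hI.mul_left _ _ (mulOp_mem_diffOps ϖ k f) _ ih)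

/-- Write the constant as a unit times `ϖ ^ v`. Lifting `P` to level `s + v` before taking
commutators leaves room for saturation to divide by `ϖ ^ v` and land in level `s`; the lifting error
only contributes a multiple of `ϖ ^ s`. -/
lemma mem_of_adOp_pow_eq [IsDomain R] [IsDiscreteValuationRing R] [CharZero R]
    (hϖ : Irreducible ϖ) (htf : ∀ a : A, ϖ • a = 0 → a = 0) (s : ℕ) (f : A)
    {P Q : Module.End R A} (hP : P ∈ I s) (m : ℕ)
    (h : (adOp R f ^ m) P = ((m.factorial : R) * ϖ ^ (k * m)) • Q) : Q ∈ I s := by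
  have hc : (m.factorial : R) * ϖ ^ (k * m) ≠ 0 :=
    mul_ne_zero (Nat.cast_ne_zero.2 m.factorial_ne_zero) (pow_ne_zero _ hϖ.ne_zero)
  obtain ⟨v, w, hv⟩ := IsDiscreteValuationRing.eq_unit_mul_pow_irreducible hc hϖ
  obtain ⟨P', hP', P'', hP'', rfl⟩ := hI.exists_lift s v hP
  obtain ⟨Q', hQ', h'⟩ := exists_adOp_pow_eq ϖ k f (hI.mem_diffOps _ _ hP') m
  obtain ⟨Q'', hQ'', h''⟩ := exists_adOp_pow_eq ϖ k f hP'' m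
  have hQ : Q = Q' + ϖ ^ s • Q'' := by
    rw [← sub_eq_zero]
    refine Module.End.smul_eq_zero_of_torsionFree
      (fun a ha => IsDiscreteValuationRing.smul_eq_zero_of_irreducible hϖ htf hc ha) ?_
    rw [smul_sub, ← h, map_add, map_smul, h', h'', smul_add, smul_comm (ϖ ^ s), sub_self]
  rw [hQ]
  refine Submodule.add_mem _ (hI.saturated_pow s v hQ' ?_) (hI.pow_smul_mem _ _ hQ'')
  have h₁ := hI.adOp_mem _ f hP' m
  rw [h', hv, mul_smul] at h₁
  simpa [smul_smul] using Submodule.smul_mem _ (↑w⁻¹ : R) h₁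

/-- The functions in `I s`. -/
def functions (s : ℕ) : Ideal A where
  carrier := {a | mulOp R a ∈ I s}
  zero_mem' := by simp [mulOp]
  add_mem' ha hb := by
    simp only [Set.mem_ofPred_eq, mulOp_add] at *
    exact Submodule.add_mem _ ha hb
  smul_mem' c a ha := by
    simp only [Set.mem_ofPred_eq, smul_eq_mul, mulOp_mul] at *
    exact hI.mul_left _ _ (mulOp_mem_diffOps ϖ k c) _ ha

lemma mem_functions {s : ℕ} {a : A} : a ∈ hI.functions s ↔ mulOp R a ∈ I s := Iff.rfl

variable [IsDomain R] [IsDiscreteValuationRing R] [CharZero R] (hϖ : Irreducible ϖ)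
  (htf : ∀ a : A, ϖ • a = 0 → a = 0) (hJ : Ideal.span (coordinateJacobians R A) = ⊤)
include hϖ htf hJ

/-- If the ideal at level one contains an operator which is not divisible by `ϖ`, then it
contains a function which is not divisible by `ϖ`. -/
lemma exists_function (hne : ∃ P ∈ I 1, ∀ Q ∈ diffOps ϖ k A, P ≠ ϖ • Q) :
    ∃ a ∈ hI.functions 1, ∀ b, a ≠ ϖ • b := by
  classical
  have hex : ∃ n, ∃ P ∈ I 1, P ∈ orderFiltration A ϖ k n ∧ ∀ Q ∈ diffOps ϖ k A, P ≠ ϖ • Q := by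
    obtain ⟨P, hP, hne⟩ := hne
    obtain ⟨n, hn⟩ := exists_mem_orderFiltration ϖ k (hI.mem_diffOps _ _ hP)
    exact ⟨n, P, hP, hn, hne⟩
  obtain ⟨P, hP, hn, hPne⟩ := Nat.find_spec hex
  have hmin : ∀ m < Nat.find hex, ∀ P ∈ I 1, P ∈ orderFiltration A ϖ k m →
      ∃ Q ∈ diffOps ϖ k A, P = ϖ • Q := by
    intro m hm P hP hPm
    by_contra! h
    exact Nat.find_min hex hm ⟨P, hP, hPm, h⟩
  generalize Nat.find hex = n at hn hmin
  cases n with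
  | zero => exact absurd (show P = 0 from hn) fun h => hPne 0 (Subalgebra.zero_mem _) (by simp [h])
  | succ n =>
    by_contra! hcon
    -- Divisibility of `P` is checked locally: it suffices that the multipliers `b` with `b P`
    -- divisible by `ϖ` form the unit ideal. Powers of the coordinate Jacobians still generate it.
    let S : Ideal A :=
      { carrier := {b | ∃ Q ∈ diffOps ϖ k A, mulOp R b * P = ϖ • Q}
        zero_mem' := ⟨0, Subalgebra.zero_mem _, by simp [mulOp_zero]⟩
        add_mem' := by
          rintro a b ⟨Q, hQ, h⟩ ⟨Q', hQ', h'⟩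
          exact ⟨Q + Q', Subalgebra.add_mem _ hQ hQ', by rw [mulOp_add, add_mul, h, h', smul_add]⟩
        smul_mem' := by
          rintro c b ⟨Q, hQ, h⟩
          exact ⟨mulOp R c * Q, Subalgebra.mul_mem _ (mulOp_mem_diffOps ϖ k c) hQ, by
            rw [smul_eq_mul, mulOp_mul, mul_assoc, h, mul_smul_comm]⟩ }
    have hS : S = ⊤ := by
      rw [← top_le_iff, ← Ideal.span_pow_eq_top _ hJ n, Ideal.span_le]
      rintro _ ⟨g, ⟨δ, f, rfl, hδ⟩, rfl⟩
      obtain ⟨q, h₁, h₂⟩ := exists_symbol ϖ k hδ P hn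
      have hq : mulOp R q ∈ I 1 := hI.mem_of_adOp_pow_eq hϖ htf 1 f hP n h₁
      obtain ⟨b, rfl⟩ := hcon q hq
      have hδn : derOp ϖ k δ ^ n ∈ diffOps ϖ k A :=
        Subalgebra.pow_mem _ (derOp_mem_diffOps ϖ k δ) n
      -- The symbol `q` is in the ideal, so subtracting the leading term stays in it and lowers the
      -- order; minimality makes the remainder divisible by `ϖ`.
      obtain ⟨Q, hQ, h⟩ := hmin n n.lt_succ_self _ (Submodule.sub_mem _
        (hI.mul_left _ _ (mulOp_mem_diffOps ϖ k (δ f ^ n)) _ hP)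
        (hI.mul_right _ _ hδn _ hq)) h₂
      refine ⟨Q + mulOp R b * derOp ϖ k δ ^ n, Subalgebra.add_mem _ hQ
        (Subalgebra.mul_mem _ (mulOp_mem_diffOps ϖ k b) hδn), ?_⟩
      rw [smul_add, ← h, mulOp_smul, smul_mul_assoc]
      abel
    obtain ⟨Q, hQ, h⟩ : (1 : A) ∈ S := hS ▸ Submodule.mem_top
    rw [mulOp_one, one_mul] at h
    exact hPne Q hQ h

/-- A function which is in `I t` up to an operator divisible by `ϖ ^ s` is in `I t` up to a
function divisible by `ϖ ^ s`. -/
lemma exists_add_mem (s t : ℕ) (a : A) {n : ℕ} :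
    ∀ P ∈ orderFiltration A ϖ k (n + 1), mulOp R a + ϖ ^ s • P ∈ I t →
      ∃ b, a + ϖ ^ s • b ∈ hI.functions t := by
  induction n with
  | zero =>
    intro P hP h
    rw [orderFiltration_succ] at hP
    obtain ⟨b, rfl⟩ := mem_mulOps.1 (show P ∈ mulOps R A by simpa [orderFiltration] using hP)
    exact ⟨b, by rwa [mem_functions, mulOp_add, mulOp_smul]⟩
  | succ n ih =>
    intro P hP h
    let S : Ideal A :=
      { carrier := {b | ∃ P' ∈ orderFiltration A ϖ k (n + 1), mulOp R (b * a) + ϖ ^ s • P' ∈ I t}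
        zero_mem' := ⟨0, Submodule.zero_mem _, by simp [mulOp_zero]⟩
        add_mem' := by
          rintro b c ⟨Q, hQ, h⟩ ⟨Q', hQ', h'⟩
          refine ⟨Q + Q', Submodule.add_mem _ hQ hQ', ?_⟩
          rw [add_mul, mulOp_add, smul_add, add_add_add_comm]
          exact Submodule.add_mem _ h h'
        smul_mem' := by
          rintro c b ⟨Q, hQ, h⟩
          refine ⟨mulOp R c * Q, mulOp_mul_mem_orderFiltration ϖ k c Q hQ, ?_⟩
          rw [smul_eq_mul, mul_assoc, mulOp_mul, ← mul_smul_comm, ← mul_add]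
          exact hI.mul_left _ _ (mulOp_mem_diffOps ϖ k c) _ h }
    have hS : S = ⊤ := by
      rw [← top_le_iff, ← Ideal.span_pow_eq_top _ hJ (n + 1), Ideal.span_le]
      rintro _ ⟨g, ⟨δ, f, rfl, hδ⟩, rfl⟩
      obtain ⟨q, h₁, h₂⟩ := exists_symbol ϖ k hδ P hP
      -- Commutators annihilate the function `a`, so only the symbol of the correction `ϖ ^ s • P`
      -- survives.
      have hq : ϖ ^ s • mulOp R q ∈ I t := by
        refine hI.mem_of_adOp_pow_eq hϖ htf t f h (n + 1) ?_
        rw [map_add, adOp_pow_succ_mulOp, zero_add, map_smul, h₁, smul_comm]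
      refine ⟨_, h₂, ?_⟩
      have := Submodule.sub_mem _
        (hI.mul_left _ _ (mulOp_mem_diffOps ϖ k (δ f ^ (n + 1))) _ h)
        (hI.mul_right _ _ (Subalgebra.pow_mem _ (derOp_mem_diffOps ϖ k δ) (n + 1)) _ hq)
      rw [mul_add, ← mulOp_mul, mul_smul_comm, smul_mul_assoc, add_sub_assoc] at this
      rw [smul_sub]
      exact this
    obtain ⟨Q, hQ, h⟩ : (1 : A) ∈ S := hS ▸ Submodule.mem_top
    rw [one_mul] at h
    exact ih Q hQ h

/-- The tower lifts `a` only to an operator; `exists_add_mem` strips the correction down to order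
zero. -/
lemma exists_lift_function (s : ℕ) {a : A} (ha : a ∈ hI.functions s) :
    ∃ b, a + ϖ ^ s • b ∈ hI.functions (s + 1) := by
  obtain ⟨P, hP, Q, hQ, h⟩ := hI.lift s _ ha
  obtain ⟨n, hn⟩ := exists_mem_orderFiltration ϖ k hQ
  refine hI.exists_add_mem hϖ htf hJ s (s + 1) a (n := n) (-Q)
    (Submodule.neg_mem _ (orderFiltration_le_succ ϖ k n hn)) ?_
  rwa [h, smul_neg, add_neg_cancel_right]

/-- The intersection of the ideals of functions contains a function not divisible by `ϖ`. -/
lemma exists_function_forall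
    (hcomplete : ∀ f : ℕ → A, (∀ n, ∃ c, f (n + 1) = f n + ϖ ^ n • c) →
      ∃ L, ∀ n, ∃ c, L = f n + ϖ ^ n • c)
    (hne : ∃ P ∈ I 1, ∀ Q ∈ diffOps ϖ k A, P ≠ ϖ • Q) :
    ∃ a, (∀ s, a ∈ hI.functions s) ∧ ∀ b, a ≠ ϖ • b := by
  obtain ⟨a, ha, hane⟩ := hI.exists_function hϖ htf hJ hne
  have hstep : ∀ (s : ℕ) (x : hI.functions (s + 1)), ∃ y : hI.functions (s + 2),
      ∃ c, (y : A) = x + ϖ ^ (s + 1) • c := by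
    rintro s ⟨x, hx⟩
    obtain ⟨b, hb⟩ := hI.exists_lift_function hϖ htf hJ (s + 1) hx
    exact ⟨⟨_, hb⟩, b, rfl⟩
  choose next hnext using hstep
  let f : ∀ s : ℕ, hI.functions (s + 1) := fun s => Nat.rec ⟨a, ha⟩ next s
  have hf : ∀ s, ∃ c : A, (f (s + 1)).1 = (f s).1 + ϖ ^ (s + 1) • c := fun s => hnext s (f s)
  have hsmul (s : ℕ) (c : A) : ϖ ^ s • c ∈ hI.functions s := by
    rw [mem_functions, mulOp_smul]
    exact hI.pow_smul_mem _ _ (mulOp_mem_diffOps ϖ k c)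
  obtain ⟨L, hL⟩ := hcomplete (fun s => (f s).1) fun s => by
    obtain ⟨c, hc⟩ := hf s
    refine ⟨ϖ • c, ?_⟩
    rw [smul_smul, ← pow_succ]
    exact hc
  refine ⟨L, fun s => ?_, fun b hb => ?_⟩
  · obtain ⟨c, hc⟩ := hL s
    rw [hc]
    exact Ideal.add_mem _ (hI.le_of_succ _ (f s).2) (hsmul s c)
  -- Convergence gives no information modulo `ϖ` at index `0`, so `L` is compared with `f 1`, which
  -- agrees with `f 0 = a` modulo `ϖ`.
  · obtain ⟨c, hc⟩ := hL 1
    obtain ⟨c', hc'⟩ : ∃ c' : A, (f 1).1 = (f 0).1 + ϖ ^ 1 • c' := hf 0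
    refine hane (b - c - c') ?_
    have h : (f 0).1 = a := rfl
    rw [hb, hc', h, pow_one] at hc
    rw [smul_sub, smul_sub, hc]
    abel

end IsIdealTower
end Tower

/-! ### Vanishing of a finite differential quotient by traces. -/

section Trace

/-- A torsion-free algebra, finite over a principal ideal domain of characteristic zero, is trivial
if `1` is a combination of values of derivations. -/
lemma subsingleton_of_derivations {R : Type u} [CommRing R] [IsDomain R] [CharZero R]
    [IsPrincipalIdealRing R] {A B : Type v} [CommRing A] [Algebra R A] [CommRing B] [Algebra R B]
    [Module.Finite R B] [Module.IsTorsionFree R B] (π : A →ₐ[R] B) (hπ : Function.Surjective π)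
    (hder : ∀ (δ : Derivation R A A), ∀ a, π a = 0 → π (δ a) = 0)
    (hspan : Ideal.span {g | ∃ (δ : Derivation R A A) (f : A), g = δ f} = ⊤) :
    Subsingleton B := by
  have : Module.Free R B := inferInstance
  let t : A →ₗ[R] R := LinearMap.trace R B ∘ₗ (Algebra.lmul R B).toLinearMap ∘ₗ π.toLinearMap
  have ht (δ : Derivation R A A) (f : A) : t (δ f) = 0 := by
    let d : Derivation R B B := Derivation.liftOfSurjective hπ (hder δ)
    have hd (a : A) : d (π a) = π (δ a) := Derivation.liftOfSurjective_apply hπ (hder δ) a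
    let m : Module.End R B := Algebra.lmul R B (π f)
    -- The Leibniz rule read as an identity of operators; a commutator has trace zero.
    have hm : Algebra.lmul R B (π (δ f)) = (d : B →ₗ[R] B) * m - m * (d : B →ₗ[R] B) := by
      ext x
      simp [m, hd, mul_comm]
    change LinearMap.trace R B (Algebra.lmul R B (π (δ f))) = 0
    rw [hm, map_sub, LinearMap.trace_mul_comm, sub_self]
  have hall : ∀ a c : A, t (c * a) = 0 := by
    intro a
    have ha : a ∈ Ideal.span {g | ∃ (δ : Derivation R A A) (f : A), g = δ f} :=
      hspan ▸ Submodule.mem_top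
    induction ha using Submodule.span_induction with
    | mem x hx =>
      obtain ⟨δ, f, rfl⟩ := hx
      -- Multiples of derivations are derivations, so `t` vanishes on the whole ideal generated by
      -- the values.
      exact fun c => ht (c • δ) f
    | zero => simp
    | add x y _ _ hx hy =>
      intro c
      rw [mul_add, map_add, hx, hy, add_zero]
    | smul r x _ hx =>
      intro c
      rw [smul_eq_mul, ← mul_assoc]
      exact hx _
  have h1 : t 1 = (Module.finrank R B : R) := by
    change LinearMap.trace R B (Algebra.lmul R B (π 1)) = _
    rw [map_one, map_one, LinearMap.trace_one]
  rw [← mul_one (1 : A), hall, eq_comm, Nat.cast_eq_zero,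
    Module.finrank_eq_zero_iff_of_free] at h1
  exact h1

end Trace

/-! ### Adic limits and Nakayama's lemma over a complete ring. -/

section Complete

variable {R : Type u} [CommRing R] {M : Type v} [AddCommGroup M] [Module R M]

lemma mem_span_singleton_pow_smul_top {ϖ : R} {n : ℕ} {x : M} :
    x ∈ (Ideal.span {ϖ} ^ n • ⊤ : Submodule R M) ↔ ∃ c, x = ϖ ^ n • c := by
  rw [Ideal.span_singleton_pow, Submodule.ideal_span_singleton_smul,
    Submodule.mem_smul_pointwise_iff_exists]
  simp [eq_comm]

lemma IsHausdorff.eq_zero_of_forall {ϖ : R} [IsHausdorff (Ideal.span {ϖ}) M] {x : M}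
    (h : ∀ n, ∃ c, x = ϖ ^ n • c) : x = 0 :=
  IsHausdorff.haus (I := Ideal.span {ϖ}) inferInstance x fun n => by
    rw [SModEq.zero, mem_span_singleton_pow_smul_top]
    exact h n

lemma isHausdorff_of_forall {ϖ : R} (h : ∀ x : M, (∀ n, ∃ c, x = ϖ ^ n • c) → x = 0) :
    IsHausdorff (Ideal.span {ϖ}) M :=
  ⟨fun x hx => h x fun n => by
    have := hx n
    rwa [SModEq.zero, mem_span_singleton_pow_smul_top] at this⟩

lemma IsPrecomplete.exists_limit {ϖ : R} [IsPrecomplete (Ideal.span {ϖ}) M] (f : ℕ → M)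
    (hf : ∀ n, ∃ c, f (n + 1) = f n + ϖ ^ n • c) : ∃ L, ∀ n, ∃ c, L = f n + ϖ ^ n • c := by
  obtain ⟨L, hL⟩ := IsPrecomplete.prec (I := Ideal.span {ϖ}) inferInstance (f := f) (by
    intro m n hmn
    induction n, hmn using Nat.le_induction with
    | base => rfl
    | succ n hmn ih =>
      refine ih.trans (SModEq.sub_mem.2 ?_)
      obtain ⟨c, hc⟩ := hf n
      rw [mem_span_singleton_pow_smul_top]
      refine ⟨-(ϖ ^ (n - m) • c), ?_⟩
      rw [hc, smul_neg, smul_smul, ← pow_add, Nat.add_sub_cancel' hmn]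
      abel)
  refine ⟨L, fun n => ?_⟩
  obtain ⟨c, hc⟩ := mem_span_singleton_pow_smul_top.1 (SModEq.sub_mem.1 (hL n))
  exact ⟨-c, by rw [smul_neg, ← hc]; abel⟩

/-- Supplies completeness of the finite free source when a surjection modulo `ϖ` is upgraded to a
surjection. -/
instance IsPrecomplete.pi_finite {ι : Type*} {I : Ideal R} [IsPrecomplete I R]
    [Finite ι] : IsPrecomplete I (ι → R) := by
  have := Fintype.ofFinite ι
  classical
  refine ⟨fun f hf => ?_⟩
  have hcoord (i : ι) {m n : ℕ} (hmn : m ≤ n) :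
      f m i ≡ f n i [SMOD (I ^ m • ⊤ : Submodule R R)] := by
    have := Submodule.mem_map_of_mem (f := LinearMap.proj (R := R) (φ := fun _ : ι => R) i)
      (SModEq.sub_mem.1 (hf hmn))
    rw [Submodule.map_smul''] at this
    exact SModEq.sub_mem.2 (Submodule.smul_mono le_rfl le_top this)
  choose L hL using fun i => IsPrecomplete.prec (I := I) (M := R) inferInstance
    (f := fun n => f n i) (hcoord i)
  refine ⟨L, fun n => SModEq.sub_mem.2 ?_⟩
  rw [pi_eq_sum_univ (f n - L)]
  refine Submodule.sum_mem _ fun i _ => Submodule.smul_mem_smul ?_ Submodule.mem_top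
  simpa using SModEq.sub_mem.1 (hL i n)

/-- A module which is separated over a complete ring, and finite modulo `ϖ`, is finite. -/
lemma Module.Finite.of_isHausdorff {ϖ : R} [IsPrecomplete (Ideal.span {ϖ}) R]
    [IsHausdorff (Ideal.span {ϖ}) M]
    [Module.Finite R (M ⧸ (Ideal.span {ϖ} • ⊤ : Submodule R M))] : Module.Finite R M := by
  obtain ⟨n, f, hf⟩ :=
    Module.Finite.exists_fin' R (M ⧸ (Ideal.span {ϖ} • ⊤ : Submodule R M))
  obtain ⟨g, hg⟩ := Module.projective_lifting_property
    (Submodule.mkQ (Ideal.span {ϖ} • ⊤ : Submodule R M)) f (Submodule.mkQ_surjective _)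
  refine Module.Finite.of_surjective g (surjective_of_mkQ_comp_surjective (I := Ideal.span {ϖ}) ?_)
  rwa [hg]

end Complete

/-! ### The differential ideal of functions in a tower is trivial. -/

section Tower

variable {R : Type u} [CommRing R] {A : Type v} [CommRing A] [Algebra R A]
variable {ϖ : R} {k : ℕ} {I : ℕ → Submodule R (Module.End R A)}

/-- A `ϖ`-saturated and closed differential ideal which contains a function whose zero locus in the
special fibre is finite is trivial. -/
lemma subsingleton_of_differential_quotient {B : Type v} [CommRing B] [Algebra R B]
    [IsDomain R] [IsDiscreteValuationRing R] [CharZero R]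
    [IsAdicComplete (IsLocalRing.maximalIdeal R) R] (hϖ : Irreducible ϖ)
    (hspan : Ideal.span {g | ∃ (δ : Derivation R A A) (f : A), g = δ f} = ⊤)
    (π : A →ₐ[R] B) (hπ : Function.Surjective π)
    (hder : ∀ (δ : Derivation R A A), ∀ a, π a = 0 → π (δ a) = 0)
    (hsat : ∀ a, π (ϖ • a) = 0 → π a = 0)
    (hclosed : ∀ a, (∀ n, ∃ c, π a = π (ϖ ^ n • c)) → π a = 0)
    {a : A} (ha : π a = 0) {N : Submodule R A} (hN : N.FG)
    (hNa : ∀ x, ∃ n ∈ N, ∃ y z, x = n + y * a + ϖ • z) : Subsingleton B := by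
  have hmax : IsLocalRing.maximalIdeal R = Ideal.span {ϖ} := hϖ.maximalIdeal_eq
  have : IsPrecomplete (Ideal.span {ϖ}) R := by
    rw [← hmax]
    infer_instance
  have : IsHausdorff (Ideal.span {ϖ}) B := isHausdorff_of_forall fun x hx => by
    obtain ⟨x, rfl⟩ := hπ x
    refine hclosed x fun n => ?_
    obtain ⟨c, hc⟩ := hx n
    obtain ⟨c, rfl⟩ := hπ c
    exact ⟨c, by rw [hc, map_smul]⟩
  have : Module.Finite R (B ⧸ (Ideal.span {ϖ} • ⊤ : Submodule R B)) := by
    have : Module.Finite R N := Module.Finite.iff_fg.2 hN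
    refine Module.Finite.of_surjective
      (Submodule.mkQ (Ideal.span {ϖ} • ⊤ : Submodule R B) ∘ₗ π.toLinearMap ∘ₗ N.subtype) ?_
    intro b
    obtain ⟨b, rfl⟩ := Submodule.mkQ_surjective _ b
    obtain ⟨x, rfl⟩ := hπ b
    obtain ⟨n, hn, y, z, rfl⟩ := hNa x
    refine ⟨⟨n, hn⟩, ?_⟩
    refine (Submodule.Quotient.eq _).2 ?_
    have h : (π.toLinearMap ∘ₗ N.subtype) ⟨n, hn⟩ - π (n + y * a + ϖ • z) = ϖ • -π z := by
      simp [ha]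
    rw [h]
    exact Submodule.smul_mem_smul (Ideal.mem_span_singleton_self ϖ) Submodule.mem_top
  have : Module.Finite R B := Module.Finite.of_isHausdorff (ϖ := ϖ)
  have : Module.IsTorsionFree R B := .of_smul_eq_zero fun r b h => by
    by_contra! hrb
    refine hrb.2 (IsDiscreteValuationRing.smul_eq_zero_of_irreducible hϖ (fun b hb => ?_) hrb.1 h)
    obtain ⟨x, rfl⟩ := hπ b
    exact hsat x (by rwa [map_smul])
  exact subsingleton_of_derivations π hπ hder hspan

/-- An ideal tower which is not contained in the multiples of `ϖ` is trivial. -/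
lemma IsIdealTower.one_mem (hI : IsIdealTower ϖ k I)
    [IsDomain R] [IsDiscreteValuationRing R] [CharZero R]
    [IsAdicComplete (IsLocalRing.maximalIdeal R) R] (hϖ : Irreducible ϖ)
    [IsAdicComplete (Ideal.span {ϖ}) A]
    (htf : ∀ a : A, ϖ • a = 0 → a = 0) (hJ : Ideal.span (coordinateJacobians R A) = ⊤)
    (hfin : ∀ a : A, (∀ b, a ≠ ϖ • b) → ∃ N : Submodule R A, N.FG ∧
      ∀ x, ∃ n ∈ N, ∃ y z, x = n + y * a + ϖ • z)
    (hne : ∃ P ∈ I 1, ∀ Q ∈ diffOps ϖ k A, P ≠ ϖ • Q) : (1 : Module.End R A) ∈ I 1 := by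
  obtain ⟨a, ha, hane⟩ := hI.exists_function_forall hϖ htf hJ IsPrecomplete.exists_limit hne
  let J : Ideal A := ⨅ s, hI.functions s
  have hJmem {x : A} : x ∈ J ↔ ∀ s, mulOp R x ∈ I s := by
    simp [J, Submodule.mem_iInf, hI.mem_functions]
  have hsat {x : A} (hx : ϖ • x ∈ J) : x ∈ J := hJmem.2 fun s =>
    hI.saturated s _ (mulOp_mem_diffOps ϖ k x) (by rw [← mulOp_smul]; exact hJmem.1 hx (s + 1))
  have hder (δ : Derivation R A A) {x : A} (hx : x ∈ J) : δ x ∈ J := hJmem.2 fun s => by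
    -- Only `ϖ ^ k • δ` is available, and its commutator with `x` is `ϖ ^ k • δ x`; starting at
    -- level `s + k` allows the division by `ϖ ^ k`.
    have h₁ := hI.mul_left _ _ (derOp_mem_diffOps ϖ k δ) _ (hJmem.1 hx (s + k))
    have h₂ := hI.mul_right _ _ (derOp_mem_diffOps ϖ k δ) _ (hJmem.1 hx (s + k))
    rw [derOp_mul_mulOp] at h₁
    have h := Submodule.sub_mem _ h₁ h₂
    rw [add_sub_cancel_left] at h
    exact hI.saturated_pow s k (mulOp_mem_diffOps ϖ k _) h
  obtain ⟨N, hN, hNa⟩ := hfin a hane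
  have hker {x : A} : Ideal.Quotient.mkₐ R J x = 0 ↔ x ∈ J := Ideal.Quotient.eq_zero_iff_mem
  have hspan : Ideal.span {g | ∃ (δ : Derivation R A A) (f : A), g = δ f} = ⊤ := by
    rw [← top_le_iff, ← hJ]
    refine Ideal.span_mono ?_
    rintro _ ⟨δ, f, h, -⟩
    exact ⟨δ, f, h⟩
  have hB : Subsingleton (A ⧸ J) := subsingleton_of_differential_quotient hϖ hspan
    (Ideal.Quotient.mkₐ R J) (Ideal.Quotient.mkₐ_surjective R J)
    (fun δ x hx => hker.2 (hder δ (hker.1 hx))) (fun x hx => hker.2 (hsat (hker.1 hx)))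
    (fun x hx => hker.2 (hJmem.2 fun s => by
      obtain ⟨c, hc⟩ := hx s
      rw [← sub_eq_zero, ← map_sub, hker] at hc
      have h := Submodule.add_mem _ (hJmem.1 hc s)
        (hI.pow_smul_mem s _ (mulOp_mem_diffOps ϖ k c))
      rwa [← mulOp_smul, ← mulOp_add, sub_add_cancel] at h))
    (hker.2 (hJmem.2 ha)) hN hNa
  have h1 : (1 : A) ∈ J := by
    rw [Ideal.Quotient.subsingleton_iff.1 hB]
    exact Submodule.mem_top
  rw [← mulOp_one]
  exact hJmem.1 h1 1

end Tower

/-! ### Arithmetic in the `ϖ`-adic completion of a torsion-free algebra. -/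

section Completion

variable {R : Type u} [CommRing R] {ϖ : R} {D : Type v} [Ring D] [Algebra R D]

lemma powIdeal_mk_eq_zero {n : ℕ} {P : D} :
    Ideal.Quotient.mk (powIdeal ϖ D n) P = 0 ↔ ∃ Q, P = ϖ ^ n • Q := by
  rw [Ideal.Quotient.eq_zero_iff_mem, powIdeal, Ideal.mem_span_singleton']
  simp_rw [← Algebra.commutes, ← Algebra.smul_def, eq_comm]

lemma powIdeal_mk_eq {n : ℕ} {P Q : D} :
    Ideal.Quotient.mk (powIdeal ϖ D n) P = Ideal.Quotient.mk (powIdeal ϖ D n) Q ↔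
      ∃ S, P = Q + ϖ ^ n • S := by
  rw [← sub_eq_zero, ← map_sub, powIdeal_mk_eq_zero]
  simp_rw [sub_eq_iff_eq_add']

namespace adicCompletionAlg

variable (x : adicCompletionAlg ϖ D)

lemma mk_of_succ {n : ℕ} {P : D} (h : x.1 (n + 1) = Ideal.Quotient.mk _ P) :
    x.1 n = Ideal.Quotient.mk _ P := by
  rw [← x.2 n, h]
  rfl

/-- The canonical map to the completion. -/
def of (ϖ : R) (P : D) : adicCompletionAlg ϖ D :=
  ⟨fun n => Ideal.Quotient.mk (powIdeal ϖ D n) P, fun _ => rfl⟩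

/-- If `x` vanishes modulo `ϖ` then it is divisible by `ϖ`. -/
lemma exists_eq_smul (htf : ∀ P : D, ϖ • P = 0 → P = 0) (hx : x.1 1 = 0) :
    ∃ y : adicCompletionAlg ϖ D, x = ϖ • y := by
  have h : ∀ n, ∃ P : D, x.1 (n + 1) = Ideal.Quotient.mk _ (ϖ • P) := by
    intro n
    obtain ⟨P, hP⟩ := Ideal.Quotient.mk_surjective (x.1 (n + 1))
    have h1 : Ideal.Quotient.mk (powIdeal ϖ D 1) P = 0 := by
      rw [← hx]
      clear hx
      induction n with
      | zero => exact hP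
      | succ n ih => exact ih (mk_of_succ x hP.symm).symm
    obtain ⟨Q, rfl⟩ := powIdeal_mk_eq_zero.1 h1
    exact ⟨Q, by rw [← hP, pow_one]⟩
  choose P hP using h
  -- Division by `ϖ` costs one level: the `n`-th component comes from `x.1 (n + 1)`, and
  -- torsion-freeness makes these components compatible.
  refine ⟨⟨fun n => Ideal.Quotient.mk _ (P n), fun n => ?_⟩, ?_⟩
  · obtain ⟨S, hS⟩ := powIdeal_mk_eq.1 ((mk_of_succ x (hP (n + 1))).symm.trans (hP n))
    refine powIdeal_mk_eq.2 ⟨S, ?_⟩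
    rw [← sub_eq_zero]
    refine htf _ ?_
    rw [smul_sub, hS, smul_add, smul_smul, ← pow_succ', sub_self]
  · ext n
    exact (mk_of_succ x (hP n)).trans rfl

/-- An element which is `1` modulo `ϖ` has a right inverse. -/
lemma exists_mul_eq_one (htf : ∀ P : D, ϖ • P = 0 → P = 0) (hx : x.1 1 = 1) :
    ∃ y, x * y = 1 := by
  obtain ⟨z, hz⟩ := exists_eq_smul (1 - x) htf (by
    change 1 - x.1 1 = 0
    rw [hx, sub_self])
  have hxz : x = 1 - ϖ • z := by rw [← hz, sub_sub_cancel]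
  have hnil (n : ℕ) : (ϖ • z.1 n) ^ n = 0 := by
    obtain ⟨P, hP⟩ := Ideal.Quotient.mk_surjective (z.1 n)
    have h : ϖ • z.1 n = Ideal.Quotient.mk _ (ϖ • P) := by rw [← hP]; rfl
    rw [h, ← map_pow, powIdeal_mk_eq_zero, smul_pow]
    exact ⟨_, rfl⟩
  -- The geometric series for the inverse of `1 - ϖ • z`, which is a finite sum modulo `ϖ ^ n`.
  refine ⟨⟨fun n => ∑ j ∈ Finset.range n, (ϖ • z.1 n) ^ j, fun n => ?_⟩, ?_⟩
  · have h := z.2 n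
    simp only [map_sum, map_pow, map_smul, h]
    rw [Finset.sum_range_succ, hnil, add_zero]
  · ext n
    rw [hxz]
    change (1 - ϖ • z.1 n) * ∑ j ∈ Finset.range n, (ϖ • z.1 n) ^ j = 1
    rw [mul_neg_geom_sum, hnil, sub_zero]

lemma eq_zero_of_smul_eq_zero (htf : ∀ P : D, ϖ • P = 0 → P = 0) (hx : ϖ • x = 0) : x = 0 := by
  ext n
  obtain ⟨P, hP⟩ := Ideal.Quotient.mk_surjective (x.1 (n + 1))
  have h : ϖ • x.1 (n + 1) = 0 := congrFun (congrArg Subtype.val hx) (n + 1)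
  rw [← hP] at h
  obtain ⟨Q, hQ⟩ := powIdeal_mk_eq_zero.1 (show Ideal.Quotient.mk _ (ϖ • P) = 0 from h)
  have hPQ : P = ϖ ^ n • Q := by
    rw [← sub_eq_zero]
    refine htf _ ?_
    rw [smul_sub, hQ, smul_smul, ← pow_succ', sub_self]
  rw [mk_of_succ x hP.symm]
  exact powIdeal_mk_eq_zero.2 ⟨Q, hPQ⟩

/-- Induction on a level where `x` is nonzero: if `x` vanishes modulo `ϖ`, dividing by `ϖ` lowers
that level by one. -/
lemma exists_apply_one_ne_zero (htf : ∀ P : D, ϖ • P = 0 → P = 0) (hx : x ≠ 0) :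
    ∃ (n : ℕ) (y : adicCompletionAlg ϖ D), x = ϖ ^ n • y ∧ y.1 1 ≠ 0 := by
  obtain ⟨m, hm⟩ : ∃ m, x.1 m ≠ 0 := by
    by_contra! h
    exact hx (by ext n; exact h n)
  induction m generalizing x with
  | zero =>
    refine absurd ?_ hm
    obtain ⟨P, hP⟩ := Ideal.Quotient.mk_surjective (x.1 0)
    rw [← hP, powIdeal_mk_eq_zero]
    exact ⟨P, by simp⟩
  | succ m ih =>
    by_cases h1 : x.1 1 = 0
    · obtain ⟨y, rfl⟩ := exists_eq_smul x htf h1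
      have hy : y.1 m ≠ 0 := by
        intro h
        obtain ⟨P, hP⟩ := Ideal.Quotient.mk_surjective (y.1 (m + 1))
        have h0 := mk_of_succ y hP.symm
        rw [h] at h0
        obtain ⟨Q, rfl⟩ := powIdeal_mk_eq_zero.1 h0.symm
        refine hm ?_
        change ϖ • y.1 (m + 1) = 0
        rw [← hP]
        exact powIdeal_mk_eq_zero.2 ⟨Q, (smul_smul _ _ _).trans (by rw [← pow_succ'])⟩
      obtain ⟨n, z, rfl, hz⟩ := ih y (fun h => hx (by rw [h, smul_zero])) hy
      exact ⟨n + 1, z, by rw [smul_smul, ← pow_succ'], hz⟩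
    · exact ⟨0, x, by simp, h1⟩

end adicCompletionAlg
end Completion

/-! ### From saturated ideals of the completion to simplicity over `K`. -/

section Simple

variable {R : Type u} [CommRing R] [IsDomain R] [IsDiscreteValuationRing R] {ϖ : R}

lemma exists_pow_smul_eq_one_tmul (hϖ : Irreducible ϖ) {K : Type w} [Field K] [Algebra R K]
    [IsFractionRing R K] {M : Type v} [AddCommGroup M] [Module R M] (z : K ⊗[R] M) :
    ∃ (n : ℕ) (x : M), ϖ ^ n • z = (1 : K) ⊗ₜ x := by
  induction z using TensorProduct.induction_on with
  | zero => exact ⟨0, 0, by simp⟩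
  | tmul c x =>
    obtain ⟨a, b, hb, rfl⟩ := IsFractionRing.div_surjective (A := R) c
    have hb0 : b ≠ 0 := nonZeroDivisors.ne_zero hb
    obtain ⟨n, u, hu⟩ := IsDiscreteValuationRing.eq_unit_mul_pow_irreducible hb0 hϖ
    refine ⟨n, (↑u⁻¹ * a : R) • x, ?_⟩
    have hb' : algebraMap R K b ≠ 0 := by simpa using hb0
    have : (ϖ ^ n : R) = ↑u⁻¹ * b := by rw [hu, ← mul_assoc, Units.inv_mul, one_mul]
    rw [TensorProduct.smul_tmul', ← TensorProduct.smul_tmul, this]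
    congr 1
    rw [Algebra.smul_def, Algebra.smul_def, map_mul, map_mul]
    field_simp
  | add z w hz hw =>
    obtain ⟨n, x, hx⟩ := hz
    obtain ⟨m, y, hy⟩ := hw
    refine ⟨n + m, ϖ ^ m • x + ϖ ^ n • y, ?_⟩
    rw [smul_add, TensorProduct.tmul_add, TensorProduct.tmul_smul, TensorProduct.tmul_smul, ← hx,
      ← hy, smul_smul, smul_smul, pow_add, mul_comm]

lemma eq_zero_of_one_tmul_eq_zero (hϖ : Irreducible ϖ) {K : Type w} [Field K] [Algebra R K]
    [IsFractionRing R K] {M : Type v} [AddCommGroup M] [Module R M]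
    (htf : ∀ x : M, ϖ • x = 0 → x = 0) {x : M} (hx : (1 : K) ⊗ₜ[R] x = 0) : x = 0 := by
  have : IsLocalizedModule (nonZeroDivisors R) (TensorProduct.mk R K M 1) :=
    (isLocalizedModule_iff_isBaseChange (nonZeroDivisors R) K _).2
      (TensorProduct.isBaseChange R M K)
  obtain ⟨c, hc⟩ := (IsLocalizedModule.eq_zero_iff (nonZeroDivisors R)
    (TensorProduct.mk R K M 1)).1 hx
  exact IsDiscreteValuationRing.smul_eq_zero_of_irreducible hϖ htf (nonZeroDivisors.ne_zero c.2) hc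

/-- `K ⊗ C` is simple if every nonzero `ϖ`-saturated two-sided ideal of `C` is trivial. -/
lemma isSimpleRing_tensorProduct (hϖ : Irreducible ϖ) {C : Type v} [Ring C] [Algebra R C]
    [Nontrivial C] (htf : ∀ x : C, ϖ • x = 0 → x = 0)
    (h : ∀ T : TwoSidedIdeal C, (∀ x, ϖ • x ∈ T → x ∈ T) → (∃ x ∈ T, x ≠ 0) → 1 ∈ T)
    (K : Type w) [Field K] [Algebra R K] [IsFractionRing R K] : IsSimpleRing (K ⊗[R] C) := by
  have hnt : Nontrivial (K ⊗[R] C) :=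
    ⟨1, 0, fun h => one_ne_zero (α := C) (eq_zero_of_one_tmul_eq_zero (K := K) hϖ htf h)⟩
  refine ⟨⟨fun T => ?_⟩⟩
  rw [or_iff_not_imp_left]
  intro hT
  let T' : TwoSidedIdeal C := T.comap (Algebra.TensorProduct.includeRight : C →ₐ[R] K ⊗[R] C)
  have hmem {x : C} : x ∈ T' ↔ (1 : K) ⊗ₜ[R] x ∈ T := TwoSidedIdeal.mem_comap _
  have h1 : (1 : C) ∈ T' := by
    refine h T' (fun x hx => ?_) ?_
    · have hne : algebraMap R K ϖ ≠ 0 := by simpa using hϖ.ne_zero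
      have := T.mul_mem_left ((algebraMap R K ϖ)⁻¹ ⊗ₜ 1) _ (hmem.1 hx)
      -- The contraction of an ideal is saturated because `ϖ` is invertible in `K`.
      rw [Algebra.TensorProduct.tmul_mul_tmul, one_mul, mul_one, TensorProduct.tmul_smul,
        TensorProduct.smul_tmul', Algebra.smul_def, mul_inv_cancel₀ hne] at this
      exact hmem.2 this
    · by_contra! hcon
      refine hT (le_bot_iff.1 fun z hz => ?_)
      obtain ⟨n, x, hx⟩ := exists_pow_smul_eq_one_tmul hϖ z
      have hzx : ϖ ^ n • z ∈ T := by
        rw [Algebra.smul_def]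
        exact T.mul_mem_left _ _ hz
      rw [hx] at hzx
      rw [hcon x (hmem.2 hzx), TensorProduct.tmul_zero] at hx
      have hne : algebraMap R K (ϖ ^ n) ≠ 0 := by simpa using pow_ne_zero n hϖ.ne_zero
      rw [TwoSidedIdeal.mem_bot]
      rw [← algebraMap_smul K] at hx
      exact (smul_eq_zero_iff_right hne).1 hx
  rw [eq_top_iff]
  intro z _
  have := T.mul_mem_left z _ (hmem.1 h1)
  rwa [← Algebra.TensorProduct.one_def, mul_one] at this

/-- Simplicity of a rational completion, in terms of the reductions of its ideals. -/
lemma isSimpleRing_adicCompletionAlg (hϖ : Irreducible ϖ) {D : Type v} [Ring D] [Algebra R D]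
    (htf : ∀ P : D, ϖ • P = 0 → P = 0) (hone : ∀ P : D, 1 ≠ ϖ • P)
    (h : ∀ I : ℕ → Submodule R D,
      (∀ s P, ∀ Q ∈ I s, P * Q ∈ I s) → (∀ s P, ∀ Q ∈ I s, Q * P ∈ I s) →
      (∀ s P, ϖ ^ s • P ∈ I s) → (∀ s, ∀ P ∈ I s, ∃ P' ∈ I (s + 1), ∃ Q, P = P' + ϖ ^ s • Q) →
      (∀ s P, ϖ • P ∈ I (s + 1) → P ∈ I s) → (∃ P ∈ I 1, ∀ Q, P ≠ ϖ • Q) → 1 ∈ I 1)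
    (K : Type w) [Field K] [Algebra R K] [IsFractionRing R K] :
    IsSimpleRing (K ⊗[R] adicCompletionAlg ϖ D) := by
  have hnt : Nontrivial (adicCompletionAlg ϖ D) := by
    refine ⟨1, 0, fun h => ?_⟩
    have h1 : Ideal.Quotient.mk (powIdeal ϖ D 1) 1 = 0 := congrFun (congrArg Subtype.val h) 1
    obtain ⟨P, hP⟩ := powIdeal_mk_eq_zero.1 h1
    exact hone P (by rw [hP, pow_one])
  refine isSimpleRing_tensorProduct hϖ
    (fun x hx => adicCompletionAlg.eq_zero_of_smul_eq_zero x htf hx) (fun T hT hT0 => ?_) K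
  let I : ℕ → Submodule R D := fun s =>
    { carrier := {P | ∃ x ∈ T, x.1 s = Ideal.Quotient.mk _ P}
      zero_mem' := ⟨0, T.zero_mem, rfl⟩
      add_mem' := by
        rintro P Q ⟨x, hx, hxP⟩ ⟨y, hy, hyQ⟩
        refine ⟨x + y, T.add_mem hx hy, ?_⟩
        change x.1 s + y.1 s = _
        rw [hxP, hyQ, map_add]
      smul_mem' := by
        rintro r P ⟨x, hx, hxP⟩
        refine ⟨r • x, ?_, ?_⟩
        · rw [Algebra.smul_def]
          exact T.mul_mem_left _ _ hx
        · change r • x.1 s = _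
          rw [hxP]
          rfl }
  obtain ⟨x, hx, hx1⟩ : (1 : D) ∈ I 1 := by
    refine h I ?_ ?_ ?_ ?_ ?_ ?_
    · rintro s P Q ⟨x, hx, hxQ⟩
      refine ⟨adicCompletionAlg.of ϖ P * x, T.mul_mem_left _ _ hx, ?_⟩
      change _ * x.1 s = _
      rw [hxQ]
      rfl
    · rintro s P Q ⟨x, hx, hxQ⟩
      refine ⟨x * adicCompletionAlg.of ϖ P, T.mul_mem_right _ _ hx, ?_⟩
      change x.1 s * _ = _
      rw [hxQ]
      rfl
    · exact fun s P => ⟨0, T.zero_mem, (powIdeal_mk_eq_zero.2 ⟨P, rfl⟩).symm⟩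
    · rintro s P ⟨x, hx, hxP⟩
      obtain ⟨P', hP'⟩ := Ideal.Quotient.mk_surjective (x.1 (s + 1))
      obtain ⟨S, hS⟩ := powIdeal_mk_eq.1
        (hxP.symm.trans (adicCompletionAlg.mk_of_succ x hP'.symm))
      exact ⟨P', ⟨x, hx, hP'.symm⟩, S, hS⟩
    · rintro s P ⟨x, hx, hxP⟩
      have h1 : x.1 1 = Ideal.Quotient.mk _ (ϖ • P) := by
        clear hx
        induction s with
        | zero => exact hxP
        | succ s ih => exact ih (adicCompletionAlg.mk_of_succ x hxP)
      -- The representative in `T` vanishes modulo `ϖ`, so it is `ϖ • y` with `y ∈ T` by saturation;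
      -- cancelling `ϖ` identifies `y` with `P` modulo `ϖ ^ s`.
      obtain ⟨y, rfl⟩ := adicCompletionAlg.exists_eq_smul x htf (by
        rw [h1]
        exact powIdeal_mk_eq_zero.2 ⟨P, by rw [pow_one]⟩)
      refine ⟨y, hT y hx, ?_⟩
      obtain ⟨Q, hQ⟩ := Ideal.Quotient.mk_surjective (y.1 (s + 1))
      have h : Ideal.Quotient.mk (powIdeal ϖ D (s + 1)) (ϖ • Q) = Ideal.Quotient.mk _ (ϖ • P) := by
        refine Eq.trans ?_ hxP
        change ϖ • Ideal.Quotient.mk (powIdeal ϖ D (s + 1)) Q = ϖ • y.1 (s + 1)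
        rw [hQ]
      obtain ⟨S, hS⟩ := powIdeal_mk_eq.1 h
      rw [adicCompletionAlg.mk_of_succ y hQ.symm]
      refine powIdeal_mk_eq.2 ⟨S, ?_⟩
      rw [← sub_eq_zero]
      refine htf _ ?_
      rw [smul_sub, hS, smul_add, smul_smul, ← pow_succ', sub_self]
    · obtain ⟨x, hx, hx0⟩ := hT0
      obtain ⟨n, y, rfl, hy⟩ := adicCompletionAlg.exists_apply_one_ne_zero x htf hx0
      have hyT : y ∈ T := by
        clear hx0
        induction n with
        | zero => simpa using hx
        | succ n ih =>
          refine ih (hT _ ?_)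
          rwa [smul_smul, ← pow_succ']
      obtain ⟨P, hP⟩ := Ideal.Quotient.mk_surjective (y.1 1)
      refine ⟨P, ⟨y, hyT, hP.symm⟩, ?_⟩
      rintro Q rfl
      refine hy ?_
      rw [← hP]
      exact powIdeal_mk_eq_zero.2 ⟨Q, by rw [pow_one]⟩
  obtain ⟨y, hy⟩ := adicCompletionAlg.exists_mul_eq_one x htf hx1
  rw [← hy]
  exact T.mul_mem_right _ _ hx

/-- Simplicity of the completed algebra of differential operators, for a `ϖ`-adically complete
flat algebra such that the Jacobians of the local coordinates generate the unit ideal, and with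
finite proper closed subsets of the special fibre. -/
theorem isSimpleRing_completedDiffOps [CharZero R]
    [IsAdicComplete (IsLocalRing.maximalIdeal R) R]
    {A : Type v} [CommRing A] [Algebra R A] (hϖ : Irreducible ϖ) (k : ℕ)
    [IsAdicComplete (Ideal.span {ϖ}) A] [Nontrivial A]
    (htf : ∀ a : A, ϖ • a = 0 → a = 0) (hJ : Ideal.span (coordinateJacobians R A) = ⊤)
    (hfin : ∀ a : A, (∀ b, a ≠ ϖ • b) → ∃ N : Submodule R A, N.FG ∧
      ∀ x, ∃ n ∈ N, ∃ y z, x = n + y * a + ϖ • z)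
    (K : Type w) [Field K] [Algebra R K] [IsFractionRing R K] :
    IsSimpleRing (K ⊗[R] completedDiffOps ϖ k A) := by
  have htfE (P : Module.End R A) (h : ϖ • P = 0) : P = 0 :=
    Module.End.smul_eq_zero_of_torsionFree htf h
  refine isSimpleRing_adicCompletionAlg hϖ
    (fun P h => Subtype.ext (htfE _ (congrArg Subtype.val h))) (fun P hP => ?_)
    (fun I hl hr h0 hlift hsat hne => ?_) K
  -- Evaluated at `1`, the equation would make `ϖ` invertible on `A`, contradicting separatedness.
  · have h1 : (1 : A) = ϖ • P.1 1 := by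
      simpa using LinearMap.congr_fun (congrArg Subtype.val hP) 1
    refine one_ne_zero (α := A) (IsHausdorff.eq_zero_of_forall (ϖ := ϖ) fun n => ⟨P.1 1 ^ n, ?_⟩)
    rw [← smul_pow, ← h1, one_pow]
  · have hI : IsIdealTower ϖ k fun s => (I s).map (diffOps ϖ k A).val.toLinearMap :=
      { mul_left := by
          rintro s P hP _ ⟨Q, hQ, rfl⟩
          exact ⟨⟨P, hP⟩ * Q, hl s _ Q hQ, rfl⟩
        mul_right := by
          rintro s P hP _ ⟨Q, hQ, rfl⟩
          exact ⟨Q * ⟨P, hP⟩, hr s _ Q hQ, rfl⟩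
        mem_diffOps := by
          rintro s _ ⟨Q, hQ, rfl⟩
          exact Q.2
        pow_smul_mem := fun s P hP => ⟨_, h0 s ⟨P, hP⟩, rfl⟩
        lift := by
          rintro s _ ⟨P, hP, rfl⟩
          obtain ⟨P', hP', Q, rfl⟩ := hlift s P hP
          exact ⟨P', ⟨P', hP', rfl⟩, Q, Q.2, rfl⟩
        saturated := by
          rintro s P hP ⟨Q, hQ, h⟩
          refine ⟨⟨P, hP⟩, hsat s _ ?_, rfl⟩
          rwa [show ϖ • (⟨P, hP⟩ : diffOps ϖ k A) = Q from Subtype.ext h.symm] }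
    obtain ⟨P, hP, h⟩ := hI.one_mem hϖ htf hJ hfin (by
      obtain ⟨P, hP, h⟩ := hne
      exact ⟨P, ⟨P, hP, rfl⟩, fun Q hQ hPQ => h ⟨Q, hQ⟩ (Subtype.ext hPQ)⟩)
    rwa [show (1 : diffOps ϖ k A) = P from Subtype.ext h.symm]

end Simple

/-! ### Reductions modulo powers of `ϖ`: lifting derivations, and flatness. -/

section QuotTensor

variable {R : Type u} [CommRing R] {A : Type v} [CommRing A] [Algebra R A]

/-- The reduction of an `R`-algebra modulo an element of `R`. -/
abbrev QuotTensor (r : R) (A : Type v) [CommRing A] [Algebra R A] :=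
  (R ⧸ Ideal.span {r}) ⊗[R] A

namespace QuotTensor

/-- The reduction map. -/
def mk (r : R) (A : Type v) [CommRing A] [Algebra R A] : A →ₐ[R] QuotTensor r A :=
  Algebra.TensorProduct.includeRight

lemma mk_surjective (r : R) : Function.Surjective (mk r A) := by
  intro x
  obtain ⟨y, hy⟩ := Submodule.Quotient.mk_surjective _
    (TensorProduct.quotTensorEquivQuotSMul A (Ideal.span {r}) x)
  refine ⟨y, (TensorProduct.quotTensorEquivQuotSMul A (Ideal.span {r})).injective ?_⟩
  rw [← hy]
  exact TensorProduct.quotTensorEquivQuotSMul_mk_one_tmul _ _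

lemma mk_eq_zero {r : R} {a : A} : mk r A a = 0 ↔ ∃ c, a = r • c := by
  rw [← (TensorProduct.quotTensorEquivQuotSMul A (Ideal.span {r})).map_eq_zero_iff]
  change TensorProduct.quotTensorEquivQuotSMul A (Ideal.span {r}) (1 ⊗ₜ a) = 0 ↔ _
  rw [TensorProduct.quotTensorEquivQuotSMul_mk_one_tmul, Submodule.Quotient.mk_eq_zero,
    Submodule.ideal_span_singleton_smul, Submodule.mem_smul_pointwise_iff_exists]
  simp [eq_comm]

lemma mk_eq_mk {r : R} {a b : A} : mk r A a = mk r A b ↔ ∃ c, a = b + r • c := by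
  rw [← sub_eq_zero, ← map_sub, mk_eq_zero]
  simp_rw [sub_eq_iff_eq_add']

/-- The transition maps between the reductions. -/
def trans {r s : R} (h : s ∣ r) (A : Type v) [CommRing A] [Algebra R A] :
    QuotTensor r A →ₐ[R] QuotTensor s A :=
  Algebra.TensorProduct.map (Ideal.Quotient.factorₐ R
    (Ideal.span_singleton_le_span_singleton.2 h)) (AlgHom.id R A)

lemma trans_mk {r s : R} (h : s ∣ r) (a : A) : trans h A (mk r A a) = mk s A a := by
  simp [trans, mk]

lemma trans_surjective {r s : R} (h : s ∣ r) : Function.Surjective (trans h A) := by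
  intro x
  obtain ⟨a, rfl⟩ := mk_surjective s x
  exact ⟨_, trans_mk h a⟩

end QuotTensor

/-- Derivations lift along surjections from formally smooth algebras. -/
lemma Derivation.exists_lift_of_formallySmooth {R' : Type u} [CommRing R'] [Algebra R R']
    (hR' : Function.Surjective (algebraMap R R')) {S T : Type v} [CommRing S] [CommRing T]
    [Algebra R S] [Algebra R T] [Algebra R' S] [IsScalarTower R R' S]
    [Algebra.FormallySmooth R' S] (π : S →ₐ[R] T) (hπ : Function.Surjective π)
    (d : Derivation R T T) : ∃ d' : Derivation R S S, ∀ s, π (d' s) = d (π s) := by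
  let := π.toRingHom.toAlgebra
  let : Algebra R' T := (π.toRingHom.comp (algebraMap R' S)).toAlgebra
  have : IsScalarTower R' S T := IsScalarTower.of_algebraMap_eq' rfl
  have hRT (r : R) (t : T) : (algebraMap R R' r) • t = r • t := by
    change π (algebraMap R' S (algebraMap R R' r)) * t = _
    rw [← IsScalarTower.algebraMap_apply, π.commutes, Algebra.smul_def]
  have hS (s : S) (t : T) : s • t = π s * t := rfl
  let D : Derivation R' S T := Derivation.mk'
    { toFun := fun s => d (π s)
      map_add' := fun x y => by rw [map_add, map_add]
      map_smul' := fun r x => by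
        obtain ⟨r, rfl⟩ := hR' r
        rw [RingHom.id_apply, hRT, algebraMap_smul, _root_.map_smul, d.map_smul] }
    fun a b => by
      change d (π (a * b)) = a • d (π b) + b • d (π a)
      rw [map_mul, d.leibniz, hS, hS]
      rfl
  -- Differentials of a formally smooth algebra are projective, so the linear form on them defined
  -- by `d ∘ π` lifts from `T` to `S`.
  obtain ⟨l, hl⟩ := Module.projective_lifting_property (Algebra.linearMap S T)
    D.liftKaehlerDifferential hπ
  let E : Derivation R' S S := l.compDer (KaehlerDifferential.D R' S)
  refine ⟨E.restrictScalars R, fun s => ?_⟩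
  have h := LinearMap.congr_fun hl (KaehlerDifferential.D R' S s)
  rw [Derivation.liftKaehlerDifferential_comp_D] at h
  exact h

variable {ϖ : R}

/-- A derivation of the reduction modulo `ϖ` lifts to the algebra, if this is complete and has
formally smooth reductions. -/
lemma Derivation.exists_lift_of_isAdicComplete {A : Type u} [CommRing A] [Algebra R A]
    [IsAdicComplete (Ideal.span {ϖ}) A]
    (hsm : ∀ n : ℕ, Algebra.FormallySmooth (R ⧸ Ideal.span {ϖ ^ (n + 1)})
      (QuotTensor (ϖ ^ (n + 1)) A))
    (d : Derivation R (QuotTensor ϖ A) (QuotTensor ϖ A)) :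
    ∃ δ : Derivation R A A, ∀ a, QuotTensor.mk ϖ A (δ a) = d (QuotTensor.mk ϖ A a) := by
  have hstep {r s : R} (h : s ∣ r) (hr : ∃ n : ℕ, r = ϖ ^ (n + 1))
      (e : Derivation R (QuotTensor s A) (QuotTensor s A)) :
      ∃ e' : Derivation R (QuotTensor r A) (QuotTensor r A),
        ∀ x, QuotTensor.trans h A (e' x) = e (QuotTensor.trans h A x) := by
    obtain ⟨n, rfl⟩ := hr
    have := hsm n
    exact Derivation.exists_lift_of_formallySmooth (R' := R ⧸ Ideal.span {ϖ ^ (n + 1)})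
      Ideal.Quotient.mk_surjective _ (QuotTensor.trans_surjective h) e
  obtain ⟨d₀, hd₀⟩ := hstep (r := ϖ ^ (0 + 1)) (s := ϖ) (by simp) ⟨0, rfl⟩ d
  choose next hnext using fun n : ℕ => hstep (pow_dvd_pow ϖ (Nat.le_succ (n + 1))) ⟨n + 1, rfl⟩
  let e : ∀ n : ℕ, Derivation R (QuotTensor (ϖ ^ (n + 1)) A) (QuotTensor (ϖ ^ (n + 1)) A) :=
    fun n => Nat.rec d₀ next n
  have he (n : ℕ) (a : A) (x : A)
      (hx : QuotTensor.mk (ϖ ^ (n + 1 + 1)) A x = e (n + 1) (QuotTensor.mk (ϖ ^ (n + 1 + 1)) A a)) :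
      QuotTensor.mk (ϖ ^ (n + 1)) A x = e n (QuotTensor.mk (ϖ ^ (n + 1)) A a) := by
    have h := hnext n (e n) (QuotTensor.mk (ϖ ^ (n + 1 + 1)) A a)
    rw [QuotTensor.trans_mk] at h
    rw [← h, ← QuotTensor.trans_mk (pow_dvd_pow ϖ (Nat.le_succ (n + 1))), hx]
  have hex (a : A) : ∃ L : A, ∀ n, QuotTensor.mk (ϖ ^ (n + 1)) A L = e n (QuotTensor.mk (ϖ ^ (n + 1)) A a) := by
    choose x hx using fun n => QuotTensor.mk_surjective (ϖ ^ (n + 1)) (e n (QuotTensor.mk (ϖ ^ (n + 1)) A a))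
    obtain ⟨L, hL⟩ := IsPrecomplete.exists_limit (ϖ := ϖ) x fun n => by
      obtain ⟨c, hc⟩ := QuotTensor.mk_eq_mk.1 ((he n a _ (hx (n + 1))).trans (hx n).symm)
      exact ⟨ϖ • c, by rw [hc, smul_smul, ← pow_succ]⟩
    refine ⟨L, fun n => ?_⟩
    obtain ⟨c, hc⟩ := hL (n + 1)
    rw [← he n a _ (hx (n + 1))]
    exact QuotTensor.mk_eq_mk.2 ⟨c, hc⟩
  -- Uniqueness of limits allows the derivation axioms to be checked modulo each power of `ϖ`.
  have huniq {x y : A} (h : ∀ n : ℕ, QuotTensor.mk (ϖ ^ (n + 1)) A x = QuotTensor.mk (ϖ ^ (n + 1)) A y) :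
      x = y := by
    rw [← sub_eq_zero]
    refine IsHausdorff.eq_zero_of_forall (ϖ := ϖ) fun n => ?_
    obtain ⟨c, hc⟩ := QuotTensor.mk_eq_mk.1 (h n)
    exact ⟨ϖ • c, by rw [hc, smul_smul, ← pow_succ, add_sub_cancel_left]⟩
  choose L hL using hex
  let δ : Derivation R A A := Derivation.mk'
    { toFun := L
      map_add' := fun x y => huniq fun n => by simp only [map_add, hL]
      map_smul' := fun r x => huniq fun n => by 
        rw [hL, RingHom.id_apply, _root_.map_smul (QuotTensor.mk (ϖ ^ (n + 1)) A) r x,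
          _root_.map_smul (QuotTensor.mk (ϖ ^ (n + 1)) A) r (L x), hL, (e n).map_smul] }
    fun a b => huniq fun n => by
      change QuotTensor.mk (ϖ ^ (n + 1)) A (L (a * b)) = QuotTensor.mk (ϖ ^ (n + 1)) A (a * L b + b * L a)
      simp only [map_add, map_mul, hL, Derivation.leibniz, smul_eq_mul]
  refine ⟨δ, fun a => ?_⟩
  change QuotTensor.mk ϖ A (L a) = _
  have h₁ := hd₀ (QuotTensor.mk (ϖ ^ (0 + 1)) A a)
  have h₂ : QuotTensor.mk (ϖ ^ (0 + 1)) A (L a) = d₀ (QuotTensor.mk (ϖ ^ (0 + 1)) A a) := hL a 0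
  rwa [← h₂, QuotTensor.trans_mk, QuotTensor.trans_mk] at h₁

/-- An algebra which is complete and has flat reductions is torsion-free. -/
lemma eq_zero_of_smul_eq_zero_of_flat [IsDomain R] (hϖ : ϖ ≠ 0) [IsHausdorff (Ideal.span {ϖ}) A]
    (hflat : ∀ n : ℕ, Module.Flat (R ⧸ Ideal.span {ϖ ^ (n + 1)}) (QuotTensor (ϖ ^ (n + 1)) A))
    {a : A} (ha : ϖ • a = 0) : a = 0 := by
  refine IsHausdorff.eq_zero_of_forall (ϖ := ϖ) fun n => ?_
  have := hflat n
  let q := algebraMap R (R ⧸ Ideal.span {ϖ ^ (n + 1)})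
  have hrel : ∑ i : Unit, (fun _ => q ϖ) i •
      (fun _ : Unit => QuotTensor.mk (ϖ ^ (n + 1)) A a) i = 0 := by
    simp only [Finset.univ_unique, Finset.sum_singleton, q, algebraMap_smul]
    rw [← map_smul, ha, map_zero]
  -- Equational criterion: modulo `ϖ ^ (n + 1)`, `a` is a combination with coefficients killed by
  -- `ϖ`, hence divisible by `ϖ ^ n`.
  obtain ⟨m, c, y, hy, hc⟩ := Module.Flat.isTrivialRelation_of_sum_smul_eq_zero hrel
  have hmem : ∃ z, QuotTensor.mk (ϖ ^ (n + 1)) A a = ϖ ^ n • z := by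
    have hc' : ∀ j, ∃ z, c () j • y j = ϖ ^ n • z := by
      intro j
      have h := hc j
      obtain ⟨r, hr⟩ := Ideal.Quotient.mk_surjective (c () j)
      simp only [Finset.univ_unique, Finset.sum_singleton] at h
      change q ϖ * c () j = 0 at h
      rw [← hr] at h
      change Ideal.Quotient.mk _ ϖ * Ideal.Quotient.mk _ r = 0 at h
      rw [← map_mul, Ideal.Quotient.eq_zero_iff_mem, Ideal.mem_span_singleton, pow_succ',
        mul_dvd_mul_iff_left hϖ] at h
      obtain ⟨r, rfl⟩ := h
      refine ⟨r • y j, ?_⟩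
      rw [← hr, smul_smul]
      exact algebraMap_smul (R ⧸ Ideal.span {ϖ ^ (n + 1)}) (ϖ ^ n * r) (y j)
    choose z hz using hc'
    refine ⟨∑ j, z j, ?_⟩
    refine (hy ()).trans ?_
    rw [Finset.smul_sum]
    exact Finset.sum_congr rfl fun j _ => hz j
  obtain ⟨z, hz⟩ := hmem
  obtain ⟨z, rfl⟩ := QuotTensor.mk_surjective _ z
  rw [← map_smul] at hz
  obtain ⟨c, hc⟩ := QuotTensor.mk_eq_mk.1 hz
  exact ⟨z + ϖ • c, by rw [hc, smul_add, smul_smul, ← pow_succ]⟩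

end QuotTensor

/-! ### Coordinate Jacobians generate the unit ideal. -/

section Jacobians

variable {R : Type u} [CommRing R] {ϖ : R} {A : Type v} [CommRing A] [Algebra R A]
  [IsAdicComplete (Ideal.span {ϖ}) A]

lemma isUnit_one_add_smul (x : A) : IsUnit (1 + ϖ • x) := by
  let f : ℕ → A := fun n => ∑ i ∈ Finset.range n, (-(ϖ • x)) ^ i
  obtain ⟨L, hL⟩ := IsPrecomplete.exists_limit (ϖ := ϖ) f fun n => by
    refine ⟨(-x) ^ n, ?_⟩
    simp only [f]
    rw [Finset.sum_range_succ, ← smul_neg, smul_pow]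
  refine IsUnit.of_mul_eq_one L ?_
  rw [← sub_eq_zero]
  refine IsHausdorff.eq_zero_of_forall (ϖ := ϖ) fun n => ?_
  obtain ⟨c, rfl⟩ := hL n
  refine ⟨(1 + ϖ • x) * c - (-x) ^ n, ?_⟩
  have h := mul_neg_geom_sum (-(ϖ • x)) n
  rw [sub_neg_eq_add] at h
  rw [mul_add, h, ← smul_neg, smul_pow, smul_sub, mul_smul_comm]
  abel

/-- If, modulo `ϖ`, derivations are pairwise proportional and their values generate the unit
ideal, then the Jacobians of the local coordinates generate the unit ideal. -/
theorem span_coordinateJacobians_eq_top (htf : ∀ a : A, ϖ • a = 0 → a = 0)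
    (hprime : ∀ a b : A, (∃ c, a * b = ϖ • c) → (∃ c, a = ϖ • c) ∨ ∃ c, b = ϖ • c)
    (hbase : ∀ (δ τ : Derivation R A A) (f h : A), ∃ c, δ f * τ h - τ f * δ h = ϖ • c)
    (hspan : ∀ J : Ideal A, (∀ (δ : Derivation R A A) (f : A), δ f ∈ J) →
      (∀ c : A, ϖ • c ∈ J) → J = ⊤) :
    Ideal.span (coordinateJacobians R A) = ⊤ := by
  have hgood (δ : Derivation R A A) (f : A) (hδ : ∀ c, δ f ≠ ϖ • c) :
      δ f ∈ coordinateJacobians R A := by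
    refine ⟨δ, f, rfl, fun τ h => ?_⟩
    -- Modulo `ϖ`, proportionality gives `δ f * σ h = 0` with `δ f` nonzero, so `σ` is divisible by
    -- `ϖ`. The quotient is again a derivation killing `f`, and the argument repeats.
    have key : ∀ (n : ℕ) (σ : Derivation R A A), σ f = 0 → ∀ h, ∃ c, σ h = ϖ ^ n • c := by
      intro n
      induction n with
      | zero => exact fun σ _ h => ⟨σ h, by simp⟩
      | succ n ih =>
        intro σ hσ
        have hdiv : ∀ h, ∃ c, σ h = ϖ • c := by
          intro h
          obtain ⟨c, hc⟩ := hbase δ σ f h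
          rw [hσ, zero_mul, sub_zero] at hc
          refine (hprime _ _ ⟨c, hc⟩).resolve_left ?_
          rintro ⟨c, hc⟩
          exact hδ c hc
        choose s hs using hdiv
        have hcancel {x y : A} (h : ϖ • x = ϖ • y) : x = y := by
          rw [← sub_eq_zero]
          exact htf _ (by rw [smul_sub, h, sub_self])
        let σ' : Derivation R A A := Derivation.mk'
          { toFun := s
            map_add' := fun x y => hcancel (by rw [smul_add, ← hs, ← hs, ← hs, map_add])
            map_smul' := fun r x => hcancel (by
              rw [RingHom.id_apply, smul_comm ϖ r, ← hs, ← hs, σ.map_smul]) }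
          fun a b => hcancel (by
            change ϖ • s (a * b) = ϖ • (a * s b + b * s a)
            rw [smul_add, ← mul_smul_comm, ← mul_smul_comm, ← hs, ← hs, ← hs, σ.leibniz]
            rfl)
        intro h
        obtain ⟨c, hc⟩ := ih σ' (htf _ ((hs f).symm.trans hσ)) h
        refine ⟨c, ?_⟩
        rw [hs h, show s h = _ from hc, smul_smul, pow_succ']
    rw [← sub_eq_zero]
    refine IsHausdorff.eq_zero_of_forall (ϖ := ϖ) fun n => ?_
    -- This combination kills `f` by construction, hence vanishes by separatedness.
    obtain ⟨c, hc⟩ := key n (δ f • τ - τ f • δ) (by simp [mul_comm]) h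
    exact ⟨c, by rw [← hc]; simp⟩
  have htop := hspan (Ideal.span (coordinateJacobians R A) ⊔ Ideal.span {algebraMap R A ϖ})
    (fun δ f => by
      by_cases h : ∃ c, δ f = ϖ • c
      · obtain ⟨c, hc⟩ := h
        rw [hc, Algebra.smul_def]
        exact Ideal.mem_sup_right (Ideal.mul_mem_right _ _ (Ideal.mem_span_singleton_self _))
      · push Not at h
        exact Ideal.mem_sup_left (Ideal.subset_span (hgood δ f h)))
    (fun c => by
      rw [Algebra.smul_def]
      exact Ideal.mem_sup_right (Ideal.mul_mem_right _ _ (Ideal.mem_span_singleton_self _)))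
  obtain ⟨x, hx, y, hy, hxy⟩ := Submodule.mem_sup.1 ((Ideal.eq_top_iff_one _).1 htop)
  obtain ⟨z, rfl⟩ := Ideal.mem_span_singleton'.1 hy
  refine Ideal.eq_top_of_isUnit_mem _ hx ?_
  have : x = 1 + ϖ • (-z) := by
    rw [smul_neg, Algebra.smul_def, mul_comm, ← hxy]
    ring
  rw [this]
  exact isUnit_one_add_smul _

end Jacobians

/-! ### Local rings of étale algebras over a principal ideal domain. -/

section PrincipalMaximal

/-- A noetherian local ring whose maximal ideal is generated by a non-zero-divisor is a domain. -/
lemma IsLocalRing.isDomain_of_maximalIdeal_eq_span {B : Type*} [CommRing B] [IsLocalRing B]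
    [IsNoetherianRing B] {π : B} (hπ : IsLocalRing.maximalIdeal B = Ideal.span {π})
    (hreg : ∀ x, π * x = 0 → x = 0) : IsDomain B := by
  -- Krull's intersection theorem prevents a nonzero element from being divisible by all powers of
  -- `π`.
  have hfactor (x : B) (hx : x ≠ 0) : ∃ (n : ℕ) (u : Bˣ), x = π ^ n * u := by
    by_contra! h
    apply hx
    have hmem : ∀ n, x ∈ IsLocalRing.maximalIdeal B ^ n := by
      intro n
      induction n with
      | zero => simp
      | succ n ih =>
        rw [hπ, Ideal.span_singleton_pow, Ideal.mem_span_singleton] at ih ⊢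
        obtain ⟨y, rfl⟩ := ih
        have hy : y ∈ IsLocalRing.maximalIdeal B := by
          rw [IsLocalRing.mem_maximalIdeal, mem_nonunits_iff]
          rintro ⟨u, rfl⟩
          exact h n u rfl
        rw [hπ, Ideal.mem_span_singleton] at hy
        rw [pow_succ]
        exact mul_dvd_mul_left _ hy
    have := Ideal.iInf_pow_eq_bot_of_isLocalRing (IsLocalRing.maximalIdeal B)
      (Ideal.IsPrime.ne_top inferInstance)
    rw [← Ideal.mem_bot, ← this, Ideal.mem_iInf]
    exact hmem
  have hpow (n : ℕ) (x : B) (h : π ^ n * x = 0) : x = 0 := by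
    induction n generalizing x with
    | zero => simpa using h
    | succ n ih => exact ih x (hreg _ (by rw [← mul_assoc, ← pow_succ', h]))
  have : NoZeroDivisors B := ⟨fun {a b} hab => by
    by_contra! h
    obtain ⟨n, u, rfl⟩ := hfactor a h.1
    obtain ⟨m, v, rfl⟩ := hfactor b h.2
    apply one_ne_zero (α := B)
    refine hpow (n + m) 1 ?_
    have : π ^ n * ↑u * (π ^ m * ↑v) = π ^ (n + m) * 1 * (↑(u * v) : B) := by
      rw [pow_add, Units.val_mul]
      ring
    rw [this] at hab
    exact (Units.mul_left_eq_zero _).1 hab⟩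
  exact NoZeroDivisors.to_isDomain B

/-- The local rings of an étale algebra over a principal ideal domain are domains with principal
maximal ideals. -/
lemma Algebra.Etale.isDomain_and_isPrincipal (P T : Type*) [CommRing P] [IsDomain P]
    [IsPrincipalIdealRing P] [CommRing T] [Algebra P T] [Algebra.Etale P T] (q : Ideal T)
    [q.IsPrime] : IsDomain (Localization.AtPrime q) ∧
      (IsLocalRing.maximalIdeal (Localization.AtPrime q)).IsPrincipal := by
  let p := q.under P
  let := Localization.AtPrime.algebraOfLiesOver p q
  have hmap := ((Algebra.isUnramifiedAt_iff_map_eq P p q).1 inferInstance).2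
  obtain ⟨π, hπ⟩ := (IsPrincipalIdealRing.principal p).principal
  rw [hπ, ← Ideal.span, Ideal.map_span, Set.image_singleton] at hmap
  have : IsNoetherianRing T := Algebra.FiniteType.isNoetherianRing P T
  have : IsNoetherianRing (Localization.AtPrime q) :=
    IsLocalization.isNoetherianRing q.primeCompl _ inferInstance
  refine ⟨?_, ⟨_, hmap.symm⟩⟩
  by_cases h : π = 0
  · have : IsField (Localization.AtPrime q) := by
      rw [IsLocalRing.isField_iff_maximalIdeal_eq, ← hmap, h, map_zero, Ideal.span_singleton_eq_bot]
    exact this.isDomain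
  · refine IsLocalRing.isDomain_of_maximalIdeal_eq_span hmap.symm fun x hx => ?_
    have : Module.IsTorsionFree P (Localization.AtPrime q) := inferInstance
    rw [← Algebra.smul_def] at hx
    exact (smul_eq_zero.1 hx).resolve_left h

end PrincipalMaximal

/-! ### Smooth affine curves over a field. -/

section SmoothCurve

variable {κ : Type u} [Field κ] {S : Type v} [CommRing S] [Algebra κ S] [Algebra.Smooth κ S]

/-- The local rings of a smooth curve over a field are domains with principal maximal ideals. -/
lemma isDomain_and_isPrincipal_of_smooth
    (hrank : ∀ p : PrimeSpectrum S, Module.rankAtStalk Ω[S⁄κ] p = 1)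
    (p : Ideal S) [p.IsPrime] :
    IsDomain (Localization.AtPrime p) ∧
      (IsLocalRing.maximalIdeal (Localization.AtPrime p)).IsPrincipal := by
  obtain ⟨f, hf, n, _, _, _⟩ :=
    Algebra.IsSmoothAt.exists_isStandardEtale_mvPolynomial (R := κ) (p := p)
  let T := Localization.Away f
  have hdisj := (Ideal.disjoint_powers_iff_notMem_of_isPrime (I := p) f).2 hf
  let q : Ideal T := p.map (algebraMap S T)
  have hq : q.IsPrime := IsLocalization.isPrime_of_isPrime_disjoint (.powers f) T p ‹_› hdisj
  have hqp : q.comap (algebraMap S T) = p :=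
    IsLocalization.under_map_of_isPrime_disjoint (.powers f) T ‹_› hdisj
  have : Algebra.FormallyEtale S T := Algebra.FormallyEtale.of_isLocalization (.powers f)
  -- Both `S` and the polynomial ring have differentials whose base change to `T` is that of `T`
  -- over `κ`; comparing ranks at `q` gives the number of variables.
  have hn : n = 1 := by
    have h₁ := congr_fun (Module.rankAtStalk_eq_of_equiv
      (KaehlerDifferential.tensorKaehlerEquivOfFormallyEtale κ S T)) ⟨q, hq⟩
    have h₂ := congr_fun (Module.rankAtStalk_eq_of_equiv
      (KaehlerDifferential.tensorKaehlerEquivOfFormallyEtale κ (MvPolynomial (Fin n) κ) T)) ⟨q, hq⟩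
    have : Module.Free (MvPolynomial (Fin n) κ) Ω[MvPolynomial (Fin n) κ⁄κ] :=
      .of_basis (KaehlerDifferential.mvPolynomialBasis κ (Fin n))
    rw [Module.rankAtStalk_baseChange, hrank] at h₁
    rw [Module.rankAtStalk_baseChange, Module.rankAtStalk_eq_finrank_of_free, ← h₁,
      Module.finrank_eq_card_basis (KaehlerDifferential.mvPolynomialBasis κ (Fin n))] at h₂
    simpa using h₂
  subst hn
  have : IsPrincipalIdealRing (MvPolynomial (Fin 1) κ) :=
    IsPrincipalIdealRing.of_surjective (MvPolynomial.uniqueAlgEquiv κ (Fin 1)).symm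
      (MvPolynomial.uniqueAlgEquiv κ (Fin 1)).symm.surjective
  obtain ⟨h₁, h₂⟩ := Algebra.Etale.isDomain_and_isPrincipal (MvPolynomial (Fin 1) κ) T q
  have hloc := IsLocalization.isLocalization_isLocalization_atPrime_isLocalization
    (.powers f) (Localization.AtPrime q) q
  have hloc : IsLocalization p.primeCompl (Localization.AtPrime q) := by
    have : (q.comap (algebraMap S T)).primeCompl = p.primeCompl := by
      ext x
      change x ∉ q.comap (algebraMap S T) ↔ x ∉ p
      rw [hqp]
    rw [← this]
    exact hloc
  let e := IsLocalization.algEquiv p.primeCompl (Localization.AtPrime q) (Localization.AtPrime p)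
  refine ⟨e.symm.injective.isDomain e.symm.toRingHom, ?_⟩
  obtain ⟨π, hπ⟩ := h₂.principal
  refine ⟨e π, ?_⟩
  ext x
  rw [← Ideal.span, Ideal.mem_span_singleton]
  have hx : x ∈ IsLocalRing.maximalIdeal (Localization.AtPrime p) ↔
      e.symm x ∈ IsLocalRing.maximalIdeal (Localization.AtPrime q) := by
    simp [IsLocalRing.mem_maximalIdeal, mem_nonunits_iff]
  rw [hx, hπ, ← Ideal.span, Ideal.mem_span_singleton, ← map_dvd_iff e]
  simp

/-- A smooth irreducible affine curve over a field has only finite proper closed subschemes. -/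
lemma finite_quotient_of_smooth [IsDomain S]
    (hrank : ∀ p : PrimeSpectrum S, Module.rankAtStalk Ω[S⁄κ] p = 1)
    {a : S} (ha : a ≠ 0) :
    Module.Finite κ (S ⧸ Ideal.span {a}) := by
  have : IsNoetherianRing S := Algebra.FiniteType.isNoetherianRing κ S
  rw [Module.finite_iff_isArtinianRing, isArtinianRing_iff_isNoetherianRing_krullDimLE_zero,
    Ring.krullDimLE_zero_iff]
  refine ⟨inferInstance, fun I hI => ?_⟩
  let P := I.comap (Ideal.Quotient.mk (Ideal.span {a}))
  have haP : a ∈ P := by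
    rw [Ideal.mem_comap, Ideal.Quotient.eq_zero_iff_mem.2 (Ideal.mem_span_singleton_self a)]
    exact I.zero_mem
  have hP : P.IsMaximal := by
    obtain ⟨m, hm, hPm⟩ := Ideal.exists_le_maximal P (Ideal.IsPrime.ne_top inferInstance)
    suffices P = m by rwa [this]
    let B := Localization.AtPrime m
    obtain ⟨_, hprinc⟩ := isDomain_and_isPrincipal_of_smooth hrank m
    have : IsNoetherianRing B := IsLocalization.isNoetherianRing m.primeCompl _ inferInstance
    -- In a noetherian local domain with principal maximal ideal, every nonzero prime is maximal;
    -- comparing extensions to `B` gives `P = m`.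
    have h := (((tfae_of_isNoetherianRing_of_isLocalRing_of_isDomain B).out 4 3 rfl rfl).1 hprinc).2
    have hdisj : Disjoint (m.primeCompl : Set S) (P : Set S) :=
      Set.disjoint_left.2 fun x hx hxP => hx (hPm hxP)
    have hPB := IsLocalization.isPrime_of_isPrime_disjoint m.primeCompl B P inferInstance hdisj
    have hmB := IsLocalization.isPrime_of_isPrime_disjoint m.primeCompl B m inferInstance
      (Set.disjoint_left.2 fun x hx hxm => hx hxm)
    have hne (Q : Ideal S) (hQ : a ∈ Q) : Q.map (algebraMap S B) ≠ ⊥ := by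
      intro hbot
      apply ha
      refine IsLocalization.injective B m.primeCompl_le_nonZeroDivisors ?_
      rw [map_zero, ← Ideal.mem_bot, ← hbot]
      exact Ideal.mem_map_of_mem _ hQ
    rw [← IsLocalization.under_map_of_isPrime_disjoint m.primeCompl B inferInstance hdisj,
      h _ (hne P haP) hPB, ← h _ (hne m (hPm haP)) hmB]
    exact IsLocalization.under_map_of_isPrime_disjoint m.primeCompl B inferInstance
      (Set.disjoint_left.2 fun x hx hxm => hx hxm)
  have := Ideal.map_eq_top_or_isMaximal_of_surjective (Ideal.Quotient.mk (Ideal.span {a}))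
    Ideal.Quotient.mk_surjective hP
  rw [Ideal.map_comap_of_surjective _ Ideal.Quotient.mk_surjective] at this
  exact this.resolve_left hI.ne_top

/-- The values of the derivations of a smooth curve generate the unit ideal. -/
lemma eq_top_of_forall_derivation_mem
    (hrank : ∀ p : PrimeSpectrum S, Module.rankAtStalk Ω[S⁄κ] p = 1)
    {J : Ideal S}
    (hJ : ∀ (d : Derivation κ S S) (s : S), d s ∈ J) : J = ⊤ := by
  by_contra h
  obtain ⟨m, hm, hJm⟩ := Ideal.exists_le_maximal J h
  obtain ⟨s, hs⟩ := Module.projective_def'.1 (inferInstance : Module.Projective S Ω[S⁄κ])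
  have hval (l : Ω[S⁄κ] →ₗ[S] S) (x : Ω[S⁄κ]) : l x ∈ m := by
    have hx : x ∈ Submodule.span S (Set.range (KaehlerDifferential.D κ S)) := by
      rw [KaehlerDifferential.span_range_derivation]
      trivial
    induction hx using Submodule.span_induction with
    | mem x hx =>
      obtain ⟨y, rfl⟩ := hx
      exact hJm (hJ (l.compDer (KaehlerDifferential.D κ S)) y)
    | zero => rw [map_zero]; exact m.zero_mem
    | add x y _ _ hx hy => rw [map_add]; exact m.add_mem hx hy
    | smul c x _ hx => rw [map_smul]; exact m.mul_mem_left _ hx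
  -- The section `s` provides coordinate functionals, all with values in `m`. Nakayama's lemma then
  -- contradicts rank one at `m`.
  have hle : (⊤ : Submodule S Ω[S⁄κ]) ≤ m • ⊤ := by
    intro x _
    have hx : x = Finsupp.linearCombination S id (s x) := (LinearMap.congr_fun hs x).symm
    rw [hx, Finsupp.linearCombination_apply]
    exact Submodule.sum_mem _ fun w _ =>
      Submodule.smul_mem_smul (hval ((Finsupp.lapply w).comp s) x) trivial
  obtain ⟨r, hr, hr0⟩ := Submodule.exists_sub_one_mem_and_smul_eq_zero_of_fg_of_le_smul m ⊤
    (Module.Finite.fg_top) hle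
  have hrm : r ∉ m := fun h' => hm.ne_top ((Ideal.eq_top_iff_one _).2 (by
    have := m.sub_mem h' hr
    rwa [sub_sub_cancel] at this))
  have hsupp : (⟨m, inferInstance⟩ : PrimeSpectrum S) ∈ Module.support S Ω[S⁄κ] := by
    rw [← Module.rankAtStalk_pos_iff_mem_support, hrank]
    exact one_pos
  obtain ⟨x, hx⟩ := Module.mem_support_iff'.1 hsupp
  exact hx r hrm (hr0 x trivial)

/-- Derivations of a smooth irreducible curve are proportional. -/
lemma derivation_mul_derivation_comm [IsDomain S]
    (hrank : ∀ p : PrimeSpectrum S, Module.rankAtStalk Ω[S⁄κ] p = 1)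
    (d e : Derivation κ S S) (f h : S) :
    d f * e h = e f * d h := by
  let D := KaehlerDifferential.D κ S
  -- At the generic point the differentials have rank one. Both derivations satisfy the resulting
  -- relation, which forces proportionality.
  have hdep : ¬ LinearIndependent S ![D f, D h] := by
    intro hli
    have h₁ := LinearIndependent.of_isLocalizedModule
      (Localization.AtPrime (⊥ : Ideal S)) (⊥ : Ideal S).primeCompl
      (LocalizedModule.mkLinearMap (⊥ : Ideal S).primeCompl Ω[S⁄κ]) hli
    have h₂ := h₁.fintype_card_le_finrank
    have h₃ : Module.finrank _ _ = 1 := hrank ⟨⊥, Ideal.isPrime_bot⟩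
    rw [h₃] at h₂
    simp at h₂
  rw [LinearIndependent.pair_iff] at hdep
  push Not at hdep
  obtain ⟨a, b, hab, hne⟩ := hdep
  have hd (d : Derivation κ S S) : a * d f + b * d h = 0 := by
    have := congr_arg d.liftKaehlerDifferential hab
    simpa [D] using this
  by_cases ha : a = 0
  · refine mul_left_cancel₀ (hne ha) ?_
    linear_combination d f * hd e - e f * hd d
  · refine mul_left_cancel₀ ha ?_
    linear_combination e h * hd d - d h * hd e

end SmoothCurve

/-! ### Transfer from the special fibre to the formal affine curve. -/

section Reduction

variable {R : Type u} [CommRing R] {ϖ : R}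

lemma Derivation.exists_quotient_linear {I : Ideal R} {S : Type v} [CommRing S] [Algebra R S]
    [Algebra (R ⧸ I) S] [IsScalarTower R (R ⧸ I) S] (d : Derivation R S S) :
    ∃ d' : Derivation (R ⧸ I) S S, ∀ s, d' s = d s := by
  refine ⟨Derivation.mk'
    { toFun := d
      map_add' := d.map_add
      map_smul' := fun c s => ?_ } d.leibniz, fun s => rfl⟩
  obtain ⟨r, rfl⟩ := Ideal.Quotient.mk_surjective c
  change d (algebraMap R (R ⧸ I) r • s) = algebraMap R (R ⧸ I) r • d s
  rw [algebraMap_smul, algebraMap_smul, d.map_smul]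

lemma Submodule.exists_fg_forall_of_surjective {M N : Type*} [AddCommGroup M] [Module R M]
    [AddCommGroup N] [Module R N] [Module.Finite R N] (f : M →ₗ[R] N)
    (hf : Function.Surjective f) : ∃ P : Submodule R M, P.FG ∧ ∀ x, ∃ y ∈ P, f x = f y := by
  obtain ⟨n, s, hs⟩ := Module.Finite.exists_fin (R := R) (M := N)
  choose t ht using fun i => hf (s i)
  refine ⟨span R (Set.range t), fg_span (Set.finite_range t), fun x => ?_⟩
  have hx : f x ∈ (span R (Set.range t)).map f := by
    rw [map_span, ← Set.range_comp, show f ∘ t = s from funext ht, hs]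
    trivial
  obtain ⟨y, hy, h⟩ := hx
  exact ⟨y, hy, h.symm⟩

variable [IsDomain R] [IsDiscreteValuationRing R]
  [IsAdicComplete (IsLocalRing.maximalIdeal R) R] [CharZero R]

/-- Simplicity of the ring of completed differential operators on an affine smooth formal curve
whose special fibre is irreducible. -/
theorem isSimpleRing_completedDiffOps_of_smooth {A : Type u} [CommRing A] [Algebra R A]
    (hϖ : Irreducible ϖ) (k : ℕ) [IsAdicComplete (Ideal.span {ϖ}) A]
    (hsm : ∀ n : ℕ, Algebra.Smooth (R ⧸ Ideal.span {ϖ ^ (n + 1)}) (QuotTensor (ϖ ^ (n + 1)) A))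
    (hsm₀ : Algebra.Smooth (R ⧸ Ideal.span {ϖ}) (QuotTensor ϖ A))
    (hrank : ∀ p : PrimeSpectrum (QuotTensor ϖ A),
      Module.rankAtStalk Ω[QuotTensor ϖ A⁄R ⧸ Ideal.span {ϖ}] p = 1)
    [IsDomain (QuotTensor ϖ A)] (K : Type w) [Field K] [Algebra R K] [IsFractionRing R K] :
    IsSimpleRing (K ⊗[R] completedDiffOps ϖ k A) := by
  have : (Ideal.span {ϖ}).IsMaximal := PrincipalIdealRing.isMaximal_of_irreducible hϖ
  let : Field (R ⧸ Ideal.span {ϖ}) := Ideal.Quotient.field _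
  have : Nontrivial A := (QuotTensor.mk ϖ A).toRingHom.domain_nontrivial
  have htf (a : A) (ha : ϖ • a = 0) : a = 0 :=
    eq_zero_of_smul_eq_zero_of_flat hϖ.ne_zero (fun n => by have := hsm n; infer_instance) ha
  refine isSimpleRing_completedDiffOps hϖ k htf (span_coordinateJacobians_eq_top htf
    (fun a b hab => ?_) (fun δ τ f h => ?_) fun J hJ hϖJ => ?_) (fun a ha => ?_) K
  · simp_rw [← QuotTensor.mk_eq_zero] at hab ⊢
    rw [map_mul] at hab
    exact mul_eq_zero.1 hab
  · have hind (δ : Derivation R A A) : ∃ d : Derivation (R ⧸ Ideal.span {ϖ}) (QuotTensor ϖ A)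
        (QuotTensor ϖ A), ∀ a, d (QuotTensor.mk ϖ A a) = QuotTensor.mk ϖ A (δ a) := by
      obtain ⟨d, hd⟩ := Derivation.exists_quotient_linear (I := Ideal.span {ϖ})
        (Derivation.liftOfSurjective (QuotTensor.mk_surjective (A := A) ϖ) (d := δ) fun x hx => by
          rw [QuotTensor.mk_eq_zero] at hx ⊢
          obtain ⟨c, rfl⟩ := hx
          exact ⟨δ c, δ.map_smul ϖ c⟩)
      refine ⟨d, fun a => ?_⟩
      rw [hd]
      exact Derivation.liftOfSurjective_apply _ _ _
    obtain ⟨d, hd⟩ := hind δ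
    obtain ⟨e, he⟩ := hind τ
    rw [← QuotTensor.mk_eq_zero, map_sub, map_mul, map_mul, ← hd, ← hd, ← he, ← he, sub_eq_zero]
    exact derivation_mul_derivation_comm hrank d e _ _
  -- Every derivation of the special fibre lifts to `A`, so the image of `J` contains all their
  -- values.
  · have htop : J.map (QuotTensor.mk ϖ A) = ⊤ := by
      refine eq_top_of_forall_derivation_mem hrank fun d s => ?_
      obtain ⟨a, rfl⟩ := QuotTensor.mk_surjective ϖ s
      obtain ⟨δ, hδ⟩ := Derivation.exists_lift_of_isAdicComplete
        (fun n => by have := hsm n; infer_instance) (d.restrictScalars R)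
      have h := Ideal.mem_map_of_mem (QuotTensor.mk ϖ A) (hJ δ a)
      rwa [hδ] at h
    have h1 : (1 : QuotTensor ϖ A) ∈ J.map (QuotTensor.mk ϖ A) := htop ▸ trivial
    obtain ⟨j, hj, hj1⟩ := (Ideal.mem_map_iff_of_surjective _
      (QuotTensor.mk_surjective (A := A) ϖ)).1 h1
    rw [← map_one (QuotTensor.mk ϖ A)] at hj1
    obtain ⟨c, hc⟩ := QuotTensor.mk_eq_mk.1 hj1.symm
    rw [Ideal.eq_top_iff_one, hc]
    exact J.add_mem hj (hϖJ c)
  · have ha' : QuotTensor.mk ϖ A a ≠ 0 := fun h => by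
      obtain ⟨c, hc⟩ := QuotTensor.mk_eq_zero.1 h
      exact ha c hc
    have hfin := finite_quotient_of_smooth hrank ha'
    have : Module.Finite R (R ⧸ Ideal.span {ϖ}) := inferInstance
    have := Module.Finite.trans (R := R) (R ⧸ Ideal.span {ϖ})
      (QuotTensor ϖ A ⧸ Ideal.span {QuotTensor.mk ϖ A a})
    obtain ⟨N, hN, h⟩ := Submodule.exists_fg_forall_of_surjective
      ((Ideal.Quotient.mkₐ R (Ideal.span {QuotTensor.mk ϖ A a})).comp
        (QuotTensor.mk ϖ A)).toLinearMap
      (Ideal.Quotient.mk_surjective.comp (QuotTensor.mk_surjective ϖ))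
    refine ⟨N, hN, fun x => ?_⟩
    obtain ⟨n, hn, h⟩ := h x
    refine ⟨n, hn, ?_⟩
    change Ideal.Quotient.mk _ (QuotTensor.mk ϖ A x) =
      Ideal.Quotient.mk _ (QuotTensor.mk ϖ A n) at h
    rw [Ideal.Quotient.eq, Ideal.mem_span_singleton'] at h
    obtain ⟨y, hy⟩ := h
    obtain ⟨y, rfl⟩ := QuotTensor.mk_surjective ϖ y
    rw [← map_mul, ← map_sub] at hy
    obtain ⟨c, hc⟩ := QuotTensor.mk_eq_mk.1 hy.symm
    refine ⟨y, c, ?_⟩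
    rw [add_assoc, ← hc]
    abel

end Reduction

/-! ### Connected spaces with integral local rings. -/

section Irreducibility

/-- A connected space is irreducible if it is so locally. -/
lemma PreirreducibleSpace.of_forall_exists_isOpen {X : Type*} [TopologicalSpace X]
    [PreconnectedSpace X] (h : ∀ x : X, ∃ U, IsOpen U ∧ x ∈ U ∧ IsPreirreducible U) :
    PreirreducibleSpace X := by
  rw [preirreducibleSpace_iff_open_dense]
  intro U hU hne
  rw [dense_iff_closure_eq]
  -- Local irreducibility makes the closure of an open set open, so connectedness makes it
  -- everything.
  refine (isClopen_iff.1 ⟨isClosed_closure, ?_⟩).resolve_left hne.closure.ne_empty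
  rw [isOpen_iff_mem_nhds]
  intro x hx
  obtain ⟨N, hN, hxN, hirr⟩ := h x
  refine Filter.mem_of_superset (hN.mem_nhds hxN) fun y hy => ?_
  rw [mem_closure_iff]
  intro W hW hyW
  obtain ⟨z, hzN, hzU⟩ := mem_closure_iff.1 hx N hN hxN
  obtain ⟨t, -, htW, htU⟩ := hirr W U hW hU ⟨y, hy, hyW⟩ ⟨z, hzN, hzU⟩
  exact ⟨t, htW, htU⟩

variable {S : Type*} [CommRing S]

/-- The spectrum of a noetherian ring is locally irreducible if the local rings are domains. -/
lemma PrimeSpectrum.exists_isPreirreducible_of_isDomain [IsNoetherianRing S]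
    (hdom : ∀ (p : Ideal S) [p.IsPrime], IsDomain (Localization.AtPrime p)) (x : PrimeSpectrum S) :
    ∃ U, IsOpen U ∧ x ∈ U ∧ IsPreirreducible U := by
  have := hdom x.asIdeal
  let P := RingHom.ker (algebraMap S (Localization.AtPrime x.asIdeal))
  have hP : P.IsPrime := RingHom.ker_isPrime _
  obtain ⟨n, t, ht⟩ := Submodule.fg_iff_exists_fin_generating_family.1
    (IsNoetherian.noetherian P)
  have hkill (i : Fin n) : ∃ f : x.asIdeal.primeCompl, f * t i = 0 := by
    have : t i ∈ P := ht ▸ Submodule.subset_span ⟨i, rfl⟩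
    exact (IsLocalization.map_eq_zero_iff x.asIdeal.primeCompl _ _).1 this
  choose f hf using hkill
  -- Since `P` is finitely generated, one `g` outside `x` kills it; every prime of `D(g)` then
  -- contains `P`, which is thus a generic point of `D(g)`.
  let g : x.asIdeal.primeCompl := ∏ i, f i
  refine ⟨basicOpen (g : S), isOpen_basicOpen, g.2, ?_⟩
  have hgP : (g : S) ∉ P := fun h => g.2 (by
    have hle : P ≤ x.asIdeal := fun a ha => by
      obtain ⟨s, hs⟩ := (IsLocalization.map_eq_zero_iff x.asIdeal.primeCompl _ _).1 ha
      exact (x.isPrime.mem_or_mem (hs ▸ x.asIdeal.zero_mem)).resolve_left s.2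
    exact hle h)
  have hmem (y : PrimeSpectrum S) (hy : y ∈ basicOpen (g : S)) (U : Set (PrimeSpectrum S))
      (hU : IsOpen U) (hyU : y ∈ U) : (⟨P, hP⟩ : PrimeSpectrum S) ∈ U := by
    have hle : P ≤ y.asIdeal := by
      rw [← ht, Submodule.span_le]
      rintro _ ⟨i, rfl⟩
      have h0 : (g : S) * t i = 0 := by
        obtain ⟨c, hc⟩ := Finset.dvd_prod_of_mem f (Finset.mem_univ i)
        rw [show g = f i * c from hc, Submonoid.coe_mul, mul_right_comm, hf, zero_mul]
      exact (y.isPrime.mem_or_mem (h0 ▸ y.asIdeal.zero_mem)).resolve_left hy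
    exact ((PrimeSpectrum.le_iff_specializes ⟨P, hP⟩ y).1 hle).mem_open hU hyU
  rintro U V hU hV ⟨y, hy, hyU⟩ ⟨z, hz, hzV⟩
  exact ⟨⟨P, hP⟩, hgP, hmem y hy U hU hyU, hmem z hz V hV hzV⟩

/-- A ring with irreducible spectrum whose local rings are domains is a domain. -/
lemma isDomain_of_irreducibleSpace [IrreducibleSpace (PrimeSpectrum S)]
    (hdom : ∀ (p : Ideal S) [p.IsPrime], IsDomain (Localization.AtPrime p)) : IsDomain S := by
  have hnil := PrimeSpectrum.irreducibleSpace_iff_isPrime_nilradical.1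
    (inferInstance : IrreducibleSpace (PrimeSpectrum S))
  have : nilradical S = ⊥ := by
    rw [eq_bot_iff]
    intro x hx
    rw [Ideal.mem_bot]
    by_contra hne
    let I : Ideal S := LinearMap.ker (LinearMap.mulRight S x)
    have hI : I ≠ ⊤ := fun h => hne (by
      have h1 : (1 : S) ∈ I := h ▸ trivial
      simpa [I] using h1)
    obtain ⟨m, hm, hIm⟩ := Ideal.exists_le_maximal I hI
    have := hdom m
    have h0 : algebraMap S (Localization.AtPrime m) x = 0 :=
      ((mem_nilradical.1 hx).map (algebraMap S (Localization.AtPrime m))).eq_zero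
    obtain ⟨s, hs⟩ := (IsLocalization.map_eq_zero_iff m.primeCompl _ _).1 h0
    exact s.2 (hIm (by simpa [I] using hs))
  rw [this] at hnil
  exact IsDomain.of_bot_isPrime S

end Irreducibility

/-! ### Integrality of the special fibre, and the main theorem. -/

namespace LRSOver

variable {R : Type u} [CommRing R] {ϖ : R} {X : LRSOver R}

/-- An affine formal open is homeomorphic to its special fibre. -/
lemma IsFormalAffine.nonempty_homeomorph {V : Opens X.toLRS} (hV : X.IsFormalAffine ϖ V) :
    Nonempty (V ≃ₜ PrimeSpectrum (QuotTensor ϖ (X.functions V))) := by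
  have hsurj := QuotTensor.mk_surjective (A := X.functions V) ϖ
  have hemb := (PrimeSpectrum.isClosedEmbedding_comap_of_surjective _
    (QuotTensor.mk ϖ (X.functions V)).toRingHom hsurj).isEmbedding
  have hrange : Set.range (X.toSpec V) =
      Set.range (PrimeSpectrum.comap (QuotTensor.mk ϖ (X.functions V)).toRingHom) := by
    rw [hV.range_eq, _root_.range_comap_of_surjective _ _ hsurj,
      ← PrimeSpectrum.zeroLocus_span]
    congr 2
    ext a
    rw [RingHom.mem_ker]
    change _ ↔ QuotTensor.mk ϖ (X.functions V) a = 0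
    rw [QuotTensor.mk_eq_zero, Ideal.mem_span_singleton']
    simp_rw [Algebra.smul_def, mul_comm, eq_comm]
  exact ⟨hV.isEmbedding.toHomeomorph.trans
    ((Homeomorph.setCongr hrange).trans hemb.toHomeomorph.symm)⟩

lemma IsSmoothFormalCurve.smooth_specialFibre (hX : X.IsSmoothFormalCurve ϖ) {V : Opens X.toLRS}
    (hV : X.IsFormalAffine ϖ V) :
    Algebra.Smooth (R ⧸ Ideal.span {ϖ}) (QuotTensor ϖ (X.functions V)) := by
  -- Generalising over `r` transports the smoothness clause at `n = 0` along `ϖ ^ (0 + 1) = ϖ`, on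
  -- which the rings themselves depend.
  have h : ∀ r : R, r = ϖ → Algebra.Smooth (R ⧸ Ideal.span {r}) (QuotTensor r (X.functions V)) →
      Algebra.Smooth (R ⧸ Ideal.span {ϖ}) (QuotTensor ϖ (X.functions V)) := by
    rintro r rfl h
    exact h
  exact h _ (by simp) (hX.smooth V hV 0)

variable [IsDomain R] [IsDiscreteValuationRing R]

lemma IsSmoothFormalCurve.isDomain_localization (hX : X.IsSmoothFormalCurve ϖ)
    (hϖ : Irreducible ϖ) {V : Opens X.toLRS} (hV : X.IsFormalAffine ϖ V)
    (p : Ideal (QuotTensor ϖ (X.functions V))) [p.IsPrime] : IsDomain (Localization.AtPrime p) := by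
  have : (Ideal.span {ϖ}).IsMaximal := PrincipalIdealRing.isMaximal_of_irreducible hϖ
  let : Field (R ⧸ Ideal.span {ϖ}) := Ideal.Quotient.field _
  have := hX.smooth_specialFibre hV
  exact (isDomain_and_isPrincipal_of_smooth (hX.relDim V hV) p).1

/-- A smooth connected formal curve is irreducible. -/
lemma IsSmoothFormalCurve.preirreducibleSpace (hX : X.IsSmoothFormalCurve ϖ)
    (hϖ : Irreducible ϖ) : PreirreducibleSpace X.toLRS := by
  have := hX.connected
  refine PreirreducibleSpace.of_forall_exists_isOpen fun x => ?_
  obtain ⟨V, hxV, hV⟩ := hX.locally_affine x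
  obtain ⟨e⟩ := hV.nonempty_homeomorph
  have := hX.smooth_specialFibre hV
  have : IsNoetherianRing (QuotTensor ϖ (X.functions V)) :=
    Algebra.FiniteType.isNoetherianRing (R ⧸ Ideal.span {ϖ}) _
  obtain ⟨U, hU, hxU, hirr⟩ := PrimeSpectrum.exists_isPreirreducible_of_isDomain
    (fun p _ => hX.isDomain_localization hϖ hV p) (e ⟨x, hxV⟩)
  have hcont : Continuous fun y => (e.symm y : X.toLRS) :=
    continuous_subtype_val.comp e.symm.continuous
  refine ⟨(fun y => (e.symm y : X.toLRS)) '' U, ?_, ⟨_, hxU, by simp⟩,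
    hirr.image _ hcont.continuousOn⟩
  exact (V.isOpen.isOpenEmbedding_subtypeVal.comp e.symm.isOpenEmbedding).isOpenMap U hU

/-- The special fibre of a nonempty affine open of a smooth connected formal curve is integral. -/
lemma IsSmoothFormalCurve.isDomain_specialFibre (hX : X.IsSmoothFormalCurve ϖ)
    (hϖ : Irreducible ϖ) {V : Opens X.toLRS} (hV : X.IsFormalAffine ϖ V)
    (hne : (V : Set X.toLRS).Nonempty) : IsDomain (QuotTensor ϖ (X.functions V)) := by
  have := hX.preirreducibleSpace hϖ
  have hirr : IsIrreducible (V : Set X.toLRS) :=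
    ⟨hne, (PreirreducibleSpace.isPreirreducible_univ).open_subset V.isOpen (Set.subset_univ _)⟩
  have : IrreducibleSpace V := isIrreducible_iff_irreducibleSpace.1 hirr
  obtain ⟨e⟩ := hV.nonempty_homeomorph
  have := e.irreducibleSpace_iff.1 this
  exact isDomain_of_irreducibleSpace fun p _ => hX.isDomain_localization hϖ hV p

end LRSOver

theorem mainTheorem10
    -- a complete discrete valuation ring of mixed characteristic with perfect residue field
    (p : ℕ) [Fact p.Prime]
    (𝒱 : Type u) [CommRing 𝒱] [IsDomain 𝒱] [IsDiscreteValuationRing 𝒱]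
    [IsAdicComplete (IsLocalRing.maximalIdeal 𝒱) 𝒱] [CharZero 𝒱]
    [CharP (IsLocalRing.ResidueField 𝒱) p] [PerfectField (IsLocalRing.ResidueField 𝒱)]
    (K : Type v) [Field K] [Algebra 𝒱 K] [IsFractionRing 𝒱 K]
    (ϖ : 𝒱) (hϖ : Irreducible ϖ)
    (X : LRSOver 𝒱) (hX : X.IsSmoothFormalCurve ϖ) (k : ℕ)
    (V : Opens X.toLRS) (hV : X.IsFormalAffine ϖ V) (hne : (V : Set X.toLRS).Nonempty) :
    IsSimpleRing (K ⊗[𝒱] completedDiffOps ϖ k (X.functions V)) := by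
  have := hV.complete
  have := hX.isDomain_specialFibre hϖ hV hne
  exact isSimpleRing_completedDiffOps_of_smooth hϖ k (hX.smooth V hV)
    (hX.smooth_specialFibre hV) (hX.relDim V hV) K
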